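/- Let $k$ be a field of characteristic zero, $N$ a free $\mathbb Z$-module of finite rank $d$, $M=\mathrm{Hom}_{\mathbb Z}(N,\mathbb Z)$, and $\sigma\subset N_{\mathbb R}$ a strongly convex rational polyhedral cone. Put $S_\sigma=\sigma^\vee\cap M$ and $V_\sigma=\mathrm{Spec}\,k[S_\sigma]$. Let $m_1,\dots,m_h$ be generators of the monoid $S_\sigma$ such that $(m_1,\dots,m_d)$ is a $\mathbb Z$-basis of $M$, and let $\mathfrak i_\sigma$ be the kernel of $k[Z_1,\dots,Z_h]\to k[S_\sigma]$, $Z_i\mapsto\chi^{m_i}$. For $d<q\le h$ let $\ell_q=(\ell_{q,1},\dots,\ell_{q,h})\in\mathbb Z^h$ be the unique vector with $\sum_i\ell_{q,i}m_i=0$, $\ell_{q,q}=1$ and $\ell_{q,q'}=0$ for every $q'>d$ with $q'\ne q$. Put $$F_q=Z_q\prod_{i\le d,\ \ell_{q,i}\ge 0}Z_i^{\ell_{q,i}}-\prod_{i\le d,\ \ell_{q,i}<0}Z_i^{-\ell_{q,i}},\qquad \mathfrak j=\langle F_q\,;\,d<q\le h\rangle\subset\mathfrak i_\sigma,\qquad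 W=\mathrm{Spec}\,k[Z_1,\dots,Z_h]/\mathfrak j\supset V_\sigma .$$ Let $k[Z_\infty]=k[Z_{i,s};\,1\le i\le h,\ s\in\mathbb N]$. For $F\in k[Z_1,\dots,Z_h]$ define $F_s\in k[Z_\infty]$ by $F\big(\sum_s Z_{1,s}t^s,\dots,\sum_s Z_{h,s}t^s\big)=\sum_s F_s t^s$; write $F_{q,s}$ for $(F_q)_s$. For an ideal $I$ of $k[Z_1,\dots,Z_h]$ let $[I]$ be the ideal of $k[Z_\infty]$ generated by all $F_s$ with $F\in I$, $s\in\mathbb N$. Thus the arc schemes are $\mathrm{Arc}(V_\sigma)=\mathrm{Spec}\,k[Z_\infty]/[\mathfrak i_\sigma]$, which is a closed subscheme of $\mathrm{Arc}(W)=\mathrm{Spec}\,k[Z_\infty]/[\mathfrak j]$. Let $n\in\sigma\cap N$. Put $\mathrm{ord}_n(f)=\inf\{\langle n,m\rangle : \chi^m \text{ occurs in } f\}$ for $f\in k[S_\sigma]$, and $\langle n,\ell_q\rangle=\sum_{\ell_{q,i}>0}\ell_{q,i}\langle n,m_i\rangle$. A point $\alpha$ of $\mathrm{Arc}(V_\sigma)$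 defines a morphism $\alpha^*:k[S_\sigma]\to\kappa(\alpha)[[t]]$ and thus a semivaluation $\mathrm{ord}_\alpha=\mathrm{ord}_t\circ\alpha^*$. The Nash set of $n$ is the closure in $\mathrm{Arc}(V_\sigma)$ of $\{\alpha:\mathrm{ord}_\alpha=\mathrm{ord}_n\}$. Then the Nash set of $n$ has a (unique) generic point $\eta_n$. Let $\eta'_n$ be its image in $\mathrm{Arc}(W)$, and let $$\mathcal R=k\big(Z_{i,s};\,i\le d,\ s\ge\langle n,m_i\rangle\big)\big[\big[Z_{i,s};\,i\le h,\ 0\le s<\langle n,m_i\rangle\big]\big].$$ There exists a $k$-algebra morphism $\hat\varepsilon:k[Z_\infty]\to\mathcal R$, with $\hat\varepsilon(Z_{i,s})=Z_{i,s}$ whenever $i\le d$ and $s\ge\langle n,m_i\rangle$, and whenever $i\le h$ and $s<\langle n,m_i\rangle$, such that: (i) The ring $\mathcal R/\langle\hat\varepsilon([\mathfrak j])\rangle$ is a complete noetherian local ring. The completion of the local ring of $\mathrm{Arc}(V_\sigma)$ at $\eta_n$ with respect to its maximal ideal (the section ring of the formal neighborhood), and the completion of the local ring of $\mathrm{Arc}(W)$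 at $\eta'_n$ with respect to its maximal ideal, are both isomorphic to $\mathcal R/\langle\hat\varepsilon([\mathfrak j])\rangle$ as $k$-algebras. (ii) For every $i\in\{1,\dots,h\}$, $\hat\varepsilon(Z_{i,\langle n,m_i\rangle})$ is a unit. (iii) For every $q\in\{d+1,\dots,h\}$ and every $s\in\mathbb N$, $\hat\varepsilon(F_{q,\langle n,\ell_q\rangle+s})=0$. -/

import Mathlib

open scoped TensorProduct

noncomputable section

namespace ToricArc

/-! ### Arc schemes of affine schemes embedded in an affine space -/

section Arc

variable {k : Type*} [Field k] {ι : Type*}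

/-- The `k`-algebra morphism `k[Z] → k[Z_∞]⟦t⟧`, `F ↦ ∑ F_s t^s`,
determined by `Z_i ↦ ∑ Z_{i,s} t^s`. -/
def HS : MvPolynomial ι k →ₐ[k] PowerSeries (MvPolynomial (ι × ℕ) k) :=
  MvPolynomial.aeval fun i => PowerSeries.mk fun s => MvPolynomial.X (i, s)

/-- The polynomial `F_s ∈ k[Z_∞]`: the coefficient of `t^s` in `F(∑ Z_{i,s} t^s)`. -/
def arcCoeff (F : MvPolynomial ι k) (s : ℕ) : MvPolynomial (ι × ℕ) k :=
  PowerSeries.coeff s (HS F)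

/-- The ideal `[I]` of `k[Z_∞]` generated by all the `F_s`, for `F ∈ I` and `s ∈ ℕ`. -/
def arcIdeal (I : Ideal (MvPolynomial ι k)) : Ideal (MvPolynomial (ι × ℕ) k) :=
  Ideal.span {G | ∃ F ∈ I, ∃ s : ℕ, G = arcCoeff F s}

/-- The coordinate ring `k[Z_∞]/[I]` of the arc scheme of `Spec (k[Z]/I)`. -/
abbrev ArcRing (I : Ideal (MvPolynomial ι k)) : Type _ :=
  MvPolynomial (ι × ℕ) k ⧸ arcIdeal I

theorem arcIdeal_mono {I J : Ideal (MvPolynomial ι k)} (h : I ≤ J) : arcIdeal I ≤ arcIdeal J :=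
  Ideal.span_mono fun _ ⟨F, hF, s, hs⟩ => ⟨F, h hF, s, hs⟩

/-- The universal arc on `Spec (k[Z]/I)`. -/
def univArc (I : Ideal (MvPolynomial ι k)) :
    (MvPolynomial ι k ⧸ I) →ₐ[k] PowerSeries (ArcRing I) :=
  Ideal.Quotient.liftₐ I ((PowerSeries.mapAlgHom (Ideal.Quotient.mkₐ k (arcIdeal I))).comp HS)
    (fun F hF => by
      ext s
      simp only [AlgHom.comp_apply, PowerSeries.mapAlgHom_apply, PowerSeries.coeff_map, map_zero]
      exact Ideal.Quotient.eq_zero_iff_mem.2 (Ideal.subset_span ⟨F, hF, s, rfl⟩))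

/-- The universal property of the arc scheme: for every `k`-algebra `R`, its `R`-points are the
`R⟦t⟧`-points of `Spec (k[Z]/I)`, by composition with the universal arc. -/
theorem bijective_univArc (I : Ideal (MvPolynomial ι k)) (R : Type*) [CommRing R] [Algebra k R] :
    Function.Bijective fun f : ArcRing I →ₐ[k] R => (PowerSeries.mapAlgHom f).comp (univArc I) := by
  have key : ∀ (f : ArcRing I →ₐ[k] R) (i : ι) (s : ℕ),
      PowerSeries.coeff s ((PowerSeries.mapAlgHom f).comp (univArc I)
        (Ideal.Quotient.mk I (MvPolynomial.X i)))
        = f (Ideal.Quotient.mk _ (MvPolynomial.X (i, s))) := by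
    intro f i s
    have h : univArc I (Ideal.Quotient.mk I (MvPolynomial.X i)) =
        PowerSeries.mapAlgHom (Ideal.Quotient.mkₐ k (arcIdeal I)) (HS (MvPolynomial.X i)) := rfl
    simp [h, HS, PowerSeries.mapAlgHom_apply]
  constructor
  · intro f g hfg
    apply Ideal.Quotient.algHom_ext
    apply MvPolynomial.algHom_ext
    rintro ⟨i, s⟩
    have := key f i s
    rw [show (PowerSeries.mapAlgHom f).comp (univArc I)
      = (PowerSeries.mapAlgHom g).comp (univArc I) from hfg, key g i s] at this
    exact this.symm
  · intro φ
    let e : MvPolynomial (ι × ℕ) k →ₐ[k] R :=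
      MvPolynomial.aeval fun p => PowerSeries.coeff p.2 (φ (Ideal.Quotient.mk I (MvPolynomial.X p.1)))
    have he : (PowerSeries.mapAlgHom e).comp HS = φ.comp (Ideal.Quotient.mkₐ k I) := by
      apply MvPolynomial.algHom_ext
      intro i
      ext s
      simp [HS, PowerSeries.mapAlgHom_apply, e]
    have hz : ∀ G ∈ arcIdeal I, e G = 0 := by
      intro G hG
      have hle : arcIdeal I ≤ RingHom.ker e := by
        refine Ideal.span_le.2 ?_
        rintro _ ⟨F, hF, s, rfl⟩
        have h1 := congrArg (PowerSeries.coeff s) (DFunLike.congr_fun he F)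
        simp only [AlgHom.comp_apply, PowerSeries.mapAlgHom_apply, PowerSeries.coeff_map,
          Ideal.Quotient.mkₐ_eq_mk, Ideal.Quotient.eq_zero_iff_mem.2 hF, map_zero] at h1
        exact h1
      exact hle hG
    refine ⟨Ideal.Quotient.liftₐ _ e hz, ?_⟩
    apply Ideal.Quotient.algHom_ext
    apply MvPolynomial.algHom_ext
    intro i
    ext s
    have := key (Ideal.Quotient.liftₐ _ e hz) i s
    simp only [AlgHom.comp_apply] at this ⊢
    refine this.trans ?_
    change e (MvPolynomial.X (i, s)) = _
    simp [e]

/-- The semivaluation `ord_α` on `k[Z]/I` attached to a point `α` of the arc scheme of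
`Spec (k[Z]/I)`: the `t`-adic order of `α^*(f) ∈ κ(α)⟦t⟧`. -/
def arcOrd {I : Ideal (MvPolynomial ι k)} (α : PrimeSpectrum (ArcRing I))
    (f : MvPolynomial ι k ⧸ I) : ℕ∞ :=
  (PowerSeries.map (algebraMap (ArcRing I) α.asIdeal.ResidueField) (univArc I f)).order

/-- For `I ≤ J`, the closed immersion from the arc scheme of `Spec (k[Z]/J)` to the arc scheme
of `Spec (k[Z]/I)`. -/
def arcImmersion {I J : Ideal (MvPolynomial ι k)} (h : I ≤ J) :
    PrimeSpectrum (ArcRing J) → PrimeSpectrum (ArcRing I) :=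
  PrimeSpectrum.comap (Ideal.Quotient.factor (arcIdeal_mono h))

end Arc

/-- The section ring of the formal neighborhood of `Spec R` at a point `x`: the completion of
the local ring at `x` with respect to its maximal ideal. -/
abbrev FormalNbhdRing {R : Type*} [CommRing R] (x : PrimeSpectrum R) : Type _ :=
  AdicCompletion (IsLocalRing.maximalIdeal (Localization.AtPrime x.asIdeal))
    (Localization.AtPrime x.asIdeal)

/-! ### Cones, and affine toric varieties with chosen generators -/

section Toric

variable {N : Type*} [AddCommGroup N]

/-- The extension `N_ℝ → ℝ` of a linear form `u ∈ M = Hom(N, ℤ)`. -/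
def realPairing (u : Module.Dual ℤ N) : (ℝ ⊗[ℤ] N) →ₗ[ℝ] ℝ :=
  (TensorProduct.AlgebraTensorModule.rid ℤ ℝ ℝ).toLinearMap ∘ₗ LinearMap.baseChange ℝ u

theorem realPairing_tmul (u : Module.Dual ℤ N) (r : ℝ) (v : N) :
    realPairing u (r ⊗ₜ[ℤ] v) = u v * r := by
  simp [realPairing]

/-- `σ` is a strongly convex rational polyhedral cone of `N_ℝ`: it is generated by finitely
many elements of `N` and it contains no line. -/
def IsToricCone (σ : PointedCone ℝ (ℝ ⊗[ℤ] N)) : Prop :=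
  (∃ S : Finset N, σ = PointedCone.hull ℝ ((fun v : N => (1 : ℝ) ⊗ₜ[ℤ] v) '' (S : Set N))) ∧
    σ.toConvexCone.Salient

/-- The monoid `S_σ = σ^∨ ∩ M`. -/
def dualMonoid (σ : PointedCone ℝ (ℝ ⊗[ℤ] N)) : AddSubmonoid (Module.Dual ℤ N) where
  carrier := {u | ∀ x ∈ σ, 0 ≤ realPairing u x}
  zero_mem' := fun x _ => by simp [realPairing]
  add_mem' := fun {u v} hu hv x hx => by
    have : realPairing (u + v) x = realPairing u x + realPairing v x := by
      simp [realPairing, LinearMap.baseChange_add]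
    rw [this]
    exact add_nonneg (hu x hx) (hv x hx)

variable {σ : PointedCone ℝ (ℝ ⊗[ℤ] N)}

/-- The toric valuation `ord_n` on `k[S_σ]`: `f` is sent to the minimum of `⟨m, n⟩` over the
characters `χ^m` that occur in `f`, and `0` is sent to `∞`. -/
def toricOrd (k : Type*) [Field k] (n : N) (f : AddMonoidAlgebra k (dualMonoid σ)) : ℕ∞ :=
  ⨅ u ∈ f.coeff.support, (((u : Module.Dual ℤ N) n).toNat : ℕ∞)

/-- Generators `m_1, …, m_h` of `S_σ` such that `m_1, …, m_d` is a `ℤ`-basis of `M`.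
The first `d` indices form `Fin d`, the remaining `h - d` ones form `Fin e`. -/
structure Generators (σ : PointedCone ℝ (ℝ ⊗[ℤ] N)) (d e : ℕ) where
  gen : Fin d ⊕ Fin e → dualMonoid σ
  closure_gen : AddSubmonoid.closure (Set.range gen) = ⊤
  basis : Module.Basis (Fin d) ℤ (Module.Dual ℤ N)
  basis_eq : ∀ i, basis i = (gen (Sum.inl i) : Module.Dual ℤ N)

variable {d e : ℕ} (g : Generators σ d e)

namespace Generators

/-- `⟨n, m_i⟩`, a nonnegative integer when `n ∈ σ ∩ N`. -/
def wt (n : N) (i : Fin d ⊕ Fin e) : ℕ := ((g.gen i : Module.Dual ℤ N) n).toNat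

/-- The relation `ℓ_q ∈ L`: `ℓ_{q,q} = 1`, `ℓ_{q,q'} = 0` for every other `q' > d`, and
`∑ ℓ_{q,i} m_i = 0`. -/
def rel (q : Fin e) : Fin d ⊕ Fin e → ℤ :=
  Sum.elim (fun i => -g.basis.repr (g.gen (Sum.inr q) : Module.Dual ℤ N) i) (Pi.single q 1)

theorem sum_rel (q : Fin e) :
    ∑ i, g.rel q i • (g.gen i : Module.Dual ℤ N) = 0 := by
  have h := g.basis.sum_repr (g.gen (Sum.inr q) : Module.Dual ℤ N)
  simp only [g.basis_eq] at h
  simp [rel, Fintype.sum_sum_type, Pi.single_apply, ite_smul, h]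

/-- `⟨n, ℓ⟩ = ⟨n, ∑_{ℓ_i > 0} ℓ_i m_i⟩`. -/
def relWt (n : N) (l : Fin d ⊕ Fin e → ℤ) : ℕ := ∑ i, (l i).toNat * g.wt n i

variable (k : Type*) [Field k]

/-- The presentation `k[Z] → k[S_σ]`, `Z_i ↦ χ^{m_i}`, of the coordinate ring of `V_σ`. -/
def chi : MvPolynomial (Fin d ⊕ Fin e) k →ₐ[k] AddMonoidAlgebra k (dualMonoid σ) :=
  MvPolynomial.aeval fun i => AddMonoidAlgebra.single (g.gen i) 1

/-- The ideal `i_σ` of `k[Z]` that defines `V_σ = Spec k[S_σ]` in the affine space. -/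
def toricIdeal : Ideal (MvPolynomial (Fin d ⊕ Fin e) k) := RingHom.ker (g.chi k)

theorem chi_monomial (a : Fin d ⊕ Fin e → ℕ) :
    g.chi k (∏ i, MvPolynomial.X i ^ a i) = AddMonoidAlgebra.single (∑ i, a i • g.gen i) 1 := by
  have h : ∀ s : Finset (Fin d ⊕ Fin e),
      ∏ i ∈ s, (AddMonoidAlgebra.single (g.gen i) (1 : k)) ^ a i
        = AddMonoidAlgebra.single (∑ i ∈ s, a i • g.gen i) 1 := by
    intro s
    induction s using Finset.induction_on with
    | empty => simp [AddMonoidAlgebra.one_def]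
    | insert j s hj ih =>
      rw [Finset.prod_insert hj, Finset.sum_insert hj, ih, AddMonoidAlgebra.single_pow,
        AddMonoidAlgebra.single_mul_single]
      simp
  simp [chi, h]

theorem chi_surjective : Function.Surjective (g.chi k) := by
  rw [← AlgHom.range_eq_top, eq_top_iff]
  rintro f -
  induction f using AddMonoidAlgebra.induction_on with
  | of u =>
    have hu : u ∈ AddSubmonoid.closure (Set.range g.gen) := by rw [g.closure_gen]; trivial
    change AddMonoidAlgebra.single u (1 : k) ∈ _
    induction hu using AddSubmonoid.closure_induction with
    | mem x hx =>
      obtain ⟨i, rfl⟩ := hx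
      exact ⟨MvPolynomial.X i, by simp [chi]⟩
    | zero => exact one_mem _
    | add x y _ _ hx hy =>
      have := mul_mem hx hy
      rwa [AddMonoidAlgebra.single_mul_single, one_mul] at this
  | add f g hf hg => exact add_mem hf hg
  | smul r f hf => exact Subalgebra.smul_mem _ hf r

/-- The identification of `k[Z]/i_σ` with the coordinate ring `k[S_σ]` of `V_σ`. -/
def coordEquiv :
    (MvPolynomial (Fin d ⊕ Fin e) k ⧸ g.toricIdeal k) ≃ₐ[k] AddMonoidAlgebra k (dualMonoid σ) :=
  Ideal.quotientKerAlgEquivOfSurjective (g.chi_surjective k)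

/-- The binomial `F_ℓ = Z^{ℓ⁺} - Z^{ℓ⁻}`. -/
def binomial (l : Fin d ⊕ Fin e → ℤ) : MvPolynomial (Fin d ⊕ Fin e) k :=
  ∏ i, MvPolynomial.X i ^ (l i).toNat - ∏ i, MvPolynomial.X i ^ (-l i).toNat

/-- The binomial `F_q = F_{ℓ_q}`, for `q > d`. -/
def F (q : Fin e) : MvPolynomial (Fin d ⊕ Fin e) k := binomial k (g.rel q)

/-- The ideal `j = ⟨F_q ; q > d⟩` of `k[Z]`, which defines `W`. -/
def ciIdeal : Ideal (MvPolynomial (Fin d ⊕ Fin e) k) := Ideal.span (Set.range (g.F k))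

theorem ciIdeal_le : g.ciIdeal k ≤ g.toricIdeal k := by
  refine Ideal.span_le.2 ?_
  rintro _ ⟨q, rfl⟩
  change g.chi k (binomial k (g.rel q)) = 0
  have h : ∑ i, (g.rel q i).toNat • g.gen i = ∑ i, (-g.rel q i).toNat • g.gen i := by
    apply Subtype.ext
    have h0 := g.sum_rel q
    rw [← sub_eq_zero]
    simp only [AddSubmonoid.coe_finsetSum]
    rw [← Finset.sum_sub_distrib, ← h0]
    refine Finset.sum_congr rfl fun i _ => ?_
    change (g.rel q i).toNat • (g.gen i : Module.Dual ℤ N) -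
      (-g.rel q i).toNat • (g.gen i : Module.Dual ℤ N) = _
    rw [← natCast_zsmul, ← natCast_zsmul, ← sub_smul, Int.toNat_sub_toNat_neg]
  rw [binomial, map_sub, chi_monomial, chi_monomial, h, sub_self]

/-- The Nash set of the toric valuation `ord_n`: the closure, in the arc scheme of `V_σ`, of
the set of the arcs `α` such that `ord_α = ord_n`. -/
def nashSet (n : N) : Set (PrimeSpectrum (ArcRing (g.toricIdeal k))) :=
  closure {α | ∀ f, arcOrd α f = toricOrd k n (g.coordEquiv k f)}

/-- The field `k(Z_{i,s} ; i ≤ d, s ≥ ⟨n, m_i⟩)`. -/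
abbrev BaseField (n : N) : Type _ :=
  FractionRing (MvPolynomial {p : Fin d × ℕ // g.wt n (Sum.inl p.1) ≤ p.2} k)

/-- The power series ring
`k(Z_{i,s} ; i ≤ d, s ≥ ⟨n, m_i⟩)⟦Z_{i,s} ; i ≤ h, s < ⟨n, m_i⟩⟧`. -/
abbrev SeriesRing (n : N) : Type _ :=
  MvPowerSeries {p : (Fin d ⊕ Fin e) × ℕ // p.2 < g.wt n p.1} (g.BaseField k n)

end Generators

end Toric

end ToricArc

end

/-! The equation `F_q = 0` is linear in `Z_q`: it reads `Z_q * posProd = negProd`, where both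
products involve only the directions `i ≤ d`. Let `T` be complete for an ideal `I`, and let the arcs
`x_i`, `i ≤ d`, be `t ^ ⟨n, m_i⟩` times a unit modulo `I`. Then `posProd` is a power of `t` times a
unit modulo `I`, and Weierstrass division shows that exactly one series `Z_q` has prescribed
coefficients below `⟨n, m_q⟩` and satisfies `F_{q,s} = 0` for all `s ≥ ⟨n, ℓ_q⟩` (`exists_solution`,
`solution_unique`). Such tuples are called truncated arcs.

Existence over `R`, with `I` generated by the variables, produces the morphism `ε` and (iii);
comparing leading terms modulo `I` gives (ii). Let `O` be the local ring at the generic arc and `m`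
its maximal ideal. Then `ε` induces `O → R/⟨ε([j])⟩`, and uniqueness over the rings `O/m^r`, where
`m` is nilpotent, produces compatible maps from `R/⟨ε([j])⟩` to `O/m^r`; this identifies the
completion. No noetherian hypothesis on `O` enters.

Replacing `j` by `i_σ` changes nothing: by Weierstrass the `x_i` are nonzerodivisors, and once they
are inverted `Z_q` is forced to be a Laurent monomial, so a truncated arc of `W` is an arc of `V_σ`
(`toricIdeal_le_ker_aeval`). Both formal neighborhoods are therefore treated together, for any ideal
between `j` and `i_σ`.

The point `η` is the kernel of the constant term of `ε`. Its leading coefficients in the directions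
`i ≤ d` are algebraically independent, so distinct Laurent monomials cannot cancel and its order
function is `ord_n` (`order_aeval_arcOf`). Any other arc with these orders is a specialization of
it, because both come from one truncated arc over a local subring of the base field
(`ker_genericArc_le`). -/

noncomputable section

namespace ToricArc

/-! ### Weierstrass division by a series of given order modulo an ideal. -/

section HasOrderMod

open PowerSeries

variable {T : Type*} [CommRing T] {I : Ideal T}

/-- Modulo the ideal `I`, the power series `P` is `X ^ p` times a unit. -/
def HasOrderMod (I : Ideal T) (p : ℕ) (P : PowerSeries T) : Prop :=
  ∃ u : PowerSeries (T ⧸ I), IsUnit u ∧ P.map (Ideal.Quotient.mk I) = X ^ p * u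

theorem HasOrderMod.one : HasOrderMod I 0 (1 : PowerSeries T) := ⟨1, isUnit_one, by simp⟩

theorem HasOrderMod.mul {p q : ℕ} {P Q : PowerSeries T} (hP : HasOrderMod I p P)
    (hQ : HasOrderMod I q Q) : HasOrderMod I (p + q) (P * Q) := by
  obtain ⟨u, hu, h⟩ := hP
  obtain ⟨v, hv, h'⟩ := hQ
  exact ⟨u * v, hu.mul hv, by rw [map_mul, h, h']; ring⟩

theorem HasOrderMod.pow {p : ℕ} {P : PowerSeries T} (hP : HasOrderMod I p P) (a : ℕ) :
    HasOrderMod I (a * p) (P ^ a) := by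
  obtain ⟨u, hu, h⟩ := hP
  exact ⟨u ^ a, hu.pow a, by rw [map_pow, h, mul_pow, ← pow_mul, mul_comm p]⟩

theorem HasOrderMod.prod {κ : Type*} (s : Finset κ) {p : κ → ℕ} {P : κ → PowerSeries T}
    (hP : ∀ i, HasOrderMod I (p i) (P i)) : HasOrderMod I (∑ i ∈ s, p i) (∏ i ∈ s, P i) := by
  classical
  induction s using Finset.induction_on with
  | empty => simpa using HasOrderMod.one
  | insert j s hj ih =>
    rw [Finset.sum_insert hj, Finset.prod_insert hj]
    exact (hP j).mul ih

theorem HasOrderMod.map {T' : Type*} [CommRing T'] {I' : Ideal T'} {p : ℕ} {P : PowerSeries T}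
    (hP : HasOrderMod I p P) (f : T →+* T') (hf : I ≤ I'.comap f) :
    HasOrderMod I' p (P.map f) := by
  obtain ⟨u, hu, h⟩ := hP
  refine ⟨u.map (Ideal.quotientMap I' f hf), hu.map _, ?_⟩
  have := congrArg (PowerSeries.map (Ideal.quotientMap I' f hf)) h
  rw [map_mul, map_pow, map_X] at this
  rw [← this]
  ext s
  simp

theorem hasOrderMod_of_coeff {p : ℕ} {P : PowerSeries T} (h : ∀ s < p, coeff s P ∈ I)
    (hu : IsUnit (coeff p P)) : HasOrderMod I p P := by
  refine ⟨mk fun s => Ideal.Quotient.mk I (coeff (s + p) P), ?_, ?_⟩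
  · rw [isUnit_iff_constantCoeff, ← coeff_zero_eq_constantCoeff_apply]
    simpa using hu.map (Ideal.Quotient.mk I)
  · ext s
    rw [coeff_X_pow_mul', coeff_map]
    split_ifs with hs
    · simp [Nat.sub_add_cancel hs]
    · exact Ideal.Quotient.eq_zero_iff_mem.2 (h s (not_le.1 hs))

theorem HasOrderMod.coeff_mem {p : ℕ} {P : PowerSeries T} (hP : HasOrderMod I p P) {s : ℕ}
    (hs : s < p) : coeff s P ∈ I := by
  obtain ⟨u, -, h⟩ := hP
  have := congrArg (coeff s) h
  rw [coeff_X_pow_mul', if_neg (not_le.2 hs), coeff_map] at this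
  exact Ideal.Quotient.eq_zero_iff_mem.1 this

/-- Completeness puts `I` in the Jacobson radical, so units modulo `I` lift. -/
theorem HasOrderMod.isUnit_coeff [IsAdicComplete I T] {p : ℕ} {P : PowerSeries T}
    (hP : HasOrderMod I p P) : IsUnit (coeff p P) := by
  obtain ⟨u, hu, h⟩ := hP
  have := congrArg (coeff p) h
  rw [coeff_X_pow_mul', if_pos le_rfl, coeff_map, Nat.sub_self] at this
  have := isLocalHom_of_le_jacobson_bot I (IsAdicComplete.le_jacobson_bot I)
  refine isUnit_of_map_unit (Ideal.Quotient.mk I) _ ?_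
  rw [‹Ideal.Quotient.mk I _ = _›, coeff_zero_eq_constantCoeff_apply]
  exact PowerSeries.isUnit_iff_constantCoeff.1 hu

theorem HasOrderMod.order_map (hI : I ≠ ⊤) {p : ℕ} {P : PowerSeries T}
    (hP : HasOrderMod I p P) : (P.map (Ideal.Quotient.mk I)).order.toNat = p := by
  obtain ⟨u, hu, h⟩ := hP
  have : Nontrivial (T ⧸ I) := Ideal.Quotient.nontrivial_iff.2 hI
  suffices (P.map (Ideal.Quotient.mk I)).order = p by simp [this]
  rw [order_eq_nat, h]
  refine ⟨?_, fun i hi => by rw [coeff_X_pow_mul', if_neg (not_le.2 hi)]⟩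
  rw [coeff_X_pow_mul', if_pos le_rfl, Nat.sub_self, coeff_zero_eq_constantCoeff_apply]
  exact (PowerSeries.isUnit_iff_constantCoeff.1 hu).ne_zero

theorem HasOrderMod.isWeierstrassDivisorAt [IsAdicComplete I T] (hI : I ≠ ⊤) {p : ℕ}
    {P : PowerSeries T} (hP : HasOrderMod I p P) : P.IsWeierstrassDivisorAt I := by
  rw [IsWeierstrassDivisorAt, hP.order_map hI]
  exact hP.isUnit_coeff

/-- The remainder of the Weierstrass division of `D` by `P` has degree less than `p`, hence is
invisible in the degrees considered. -/
theorem HasOrderMod.exists_coeff_mul_eq [IsAdicComplete I T] {p : ℕ} {P : PowerSeries T}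
    (hP : HasOrderMod I p P) (D : PowerSeries T) :
    ∃ y : PowerSeries T, ∀ s, p ≤ s → coeff s (y * P) = coeff s D := by
  -- Weierstrass division needs a proper ideal; a ring that is complete for the unit ideal is zero.
  by_cases hI : I = ⊤
  · subst hI
    have := ‹IsAdicComplete ⊤ T›.toIsHausdorff.subsingleton
    exact ⟨0, fun s _ => Subsingleton.elim _ _⟩
  have H := (hP.isWeierstrassDivisorAt hI).isWeierstrassDivisionAt_div_mod D
  have hdeg := H.degree_lt
  rw [hP.order_map hI] at hdeg
  refine ⟨(hP.isWeierstrassDivisorAt hI).div D, fun s hs => ?_⟩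
  have hr : ((hP.isWeierstrassDivisorAt hI).mod D).coeff s = 0 :=
    Polynomial.coeff_eq_zero_of_degree_lt (hdeg.trans_le (by exact_mod_cast hs))
  conv_rhs => rw [H.eq_mul_add]
  rw [map_add, Polynomial.coeff_coe, hr, add_zero, mul_comm]

theorem HasOrderMod.eq_zero_of_coeff_mul [IsAdicComplete I T] {p : ℕ} {P z : PowerSeries T}
    (hP : HasOrderMod I p P) (h : ∀ s, p ≤ s → coeff s (z * P) = 0) : z = 0 := by
  by_cases hI : I = ⊤
  · subst hI
    have := ‹IsAdicComplete ⊤ T›.toIsHausdorff.subsingleton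
    exact Subsingleton.elim _ _
  refine ((hP.isWeierstrassDivisorAt hI).eq_zero_of_mul_eq (r := (P * z).trunc p) ?_ ?_).1
  · rw [hP.order_map hI]
    exact degree_trunc_lt _ _
  · ext s
    rw [Polynomial.coeff_coe, coeff_trunc]
    split_ifs with hs
    · rfl
    · rw [mul_comm, h s (not_lt.1 hs)]

/-- This allows the arcs in the directions `i ≤ d` to be inverted although `T` need not be a domain.
-/
theorem HasOrderMod.mem_nonZeroDivisors [IsAdicComplete I T] {p : ℕ} {P : PowerSeries T}
    (hP : HasOrderMod I p P) : P ∈ nonZeroDivisors (PowerSeries T) :=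
  mem_nonZeroDivisors_iff_right.2 fun z hz => hP.eq_zero_of_coeff_mul fun s _ => by simp [hz]

end HasOrderMod

/-! ### Points of arc spaces with values in an algebra. -/

section Arc

variable {k : Type*} [Field k] {ι : Type*} {T T' : Type*} [CommRing T] [Algebra k T] [CommRing T']
  [Algebra k T']

/-- The arc `Z_i ↦ ∑ φ(Z_{i,s}) t^s` attached to a `T`-point `φ` of the arc space. -/
def arcOf (φ : MvPolynomial (ι × ℕ) k →ₐ[k] T) (i : ι) : PowerSeries T :=
  PowerSeries.mk fun s => φ (MvPolynomial.X (i, s))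

@[simp]
theorem coeff_arcOf (φ : MvPolynomial (ι × ℕ) k →ₐ[k] T) (i : ι) (s : ℕ) :
    PowerSeries.coeff s (arcOf φ i) = φ (MvPolynomial.X (i, s)) := by
  simp [arcOf]

theorem arcOf_comp (f : T →ₐ[k] T') (φ : MvPolynomial (ι × ℕ) k →ₐ[k] T) (i : ι) :
    arcOf (f.comp φ) i = (arcOf φ i).map (f : T →+* T') := by
  ext s
  simp

theorem mapAlgHom_comp_HS (φ : MvPolynomial (ι × ℕ) k →ₐ[k] T) :
    (PowerSeries.mapAlgHom φ).comp HS = MvPolynomial.aeval (R := k) (arcOf φ) := by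
  apply MvPolynomial.algHom_ext
  intro i
  ext s
  simp [HS, PowerSeries.mapAlgHom_apply]

theorem apply_arcCoeff (φ : MvPolynomial (ι × ℕ) k →ₐ[k] T) (F : MvPolynomial ι k) (s : ℕ) :
    φ (arcCoeff F s) = PowerSeries.coeff s (MvPolynomial.aeval (arcOf φ) F) := by
  rw [← mapAlgHom_comp_HS]
  simp [arcCoeff, PowerSeries.mapAlgHom_apply]

theorem arcIdeal_le_ker_iff (φ : MvPolynomial (ι × ℕ) k →ₐ[k] T)
    (I : Ideal (MvPolynomial ι k)) :
    arcIdeal I ≤ RingHom.ker φ ↔ I ≤ RingHom.ker (MvPolynomial.aeval (R := k) (arcOf φ)) := by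
  rw [arcIdeal, Ideal.span_le]
  constructor
  · intro h F hF
    rw [RingHom.mem_ker]
    ext s
    rw [← apply_arcCoeff, map_zero]
    exact h ⟨F, hF, s, rfl⟩
  · rintro h _ ⟨F, hF, s, rfl⟩
    change φ _ = 0
    rw [apply_arcCoeff, show MvPolynomial.aeval (arcOf φ) F = 0 from h hF, map_zero]

end Arc

/-! ### The equations `F_q`, linear in `Z_q`, and truncated arcs. -/

namespace Generators

variable {N : Type*} [AddCommGroup N] {σ : PointedCone ℝ (ℝ ⊗[ℤ] N)} {d e : ℕ}
  (g : Generators σ d e)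

/-- The product of the `x_i ^ ℓ_{q,i}`, over the `i ≤ d` with `ℓ_{q,i} ≥ 0`. -/
def posProd {B : Type*} [CommMonoid B] (q : Fin e) (x : Fin d → B) : B :=
  ∏ i, x i ^ (g.rel q (Sum.inl i)).toNat

/-- The product of the `x_i ^ (-ℓ_{q,i})`, over the `i ≤ d` with `ℓ_{q,i} ≤ 0`. -/
def negProd {B : Type*} [CommMonoid B] (q : Fin e) (x : Fin d → B) : B :=
  ∏ i, x i ^ (-g.rel q (Sum.inl i)).toNat

theorem map_posProd {B C : Type*} [CommMonoid B] [CommMonoid C] {G : Type*} [FunLike G B C]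
    [MonoidHomClass G B C] (f : G) (q : Fin e) (x : Fin d → B) :
    f (g.posProd q x) = g.posProd q fun i => f (x i) := by
  simp [posProd, map_prod]

/-- The order of `posProd`. -/
def posWt (n : N) (q : Fin e) : ℕ := ∑ i, (g.rel q (Sum.inl i)).toNat * g.wt n (Sum.inl i)

/-- The order of `negProd`. -/
def negWt (n : N) (q : Fin e) : ℕ := ∑ i, (-g.rel q (Sum.inl i)).toNat * g.wt n (Sum.inl i)

variable {k : Type*} [Field k]

theorem aeval_F {B : Type*} [CommRing B] [Algebra k B] (x : Fin d ⊕ Fin e → B) (q : Fin e) :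
    MvPolynomial.aeval x (g.F k q) =
      x (Sum.inr q) * g.posProd q (fun i => x (Sum.inl i)) -
        g.negProd q (fun i => x (Sum.inl i)) := by
  have h1 : ∀ j : Fin e, x (Sum.inr j) ^ ((Pi.single q 1 : Fin e → ℤ) j).toNat =
      if j = q then x (Sum.inr q) else 1 := by
    intro j
    by_cases h : j = q
    · subst h; simp
    · simp [h]
  have h2 : ∀ j : Fin e, x (Sum.inr j) ^ (-(Pi.single q 1 : Fin e → ℤ) j).toNat = 1 := by
    intro j
    by_cases h : j = q
    · subst h; simp
    · simp [h]
  simp only [F, binomial, map_sub, map_mul, map_prod, map_pow, MvPolynomial.aeval_X,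
    Fintype.prod_sum_type,
    posProd, negProd]
  have h3 : ∀ j, g.rel q (Sum.inr j) = (Pi.single q 1 : Fin e → ℤ) j := fun _ => rfl
  simp only [h3, h1, h2, Finset.prod_ite_eq', Finset.mem_univ, if_true, Finset.prod_const_one,
    mul_one]
  ring

theorem relWt_eq_add (n : N) (q : Fin e) :
    g.relWt n (g.rel q) = g.wt n (Sum.inr q) + g.posWt n q := by
  have h : ∀ j, (g.rel q (Sum.inr j)).toNat * g.wt n (Sum.inr j) =
      if j = q then g.wt n (Sum.inr q) else 0 := by
    intro j
    change ((Pi.single q 1 : Fin e → ℤ) j).toNat * _ = _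
    by_cases h : j = q
    · subst h; simp
    · simp [h]
  rw [relWt, Fintype.sum_sum_type, posWt, add_comm]
  simp [h]

/-- `n` is nonnegative on the generators of `S_σ`. -/
def IsNonneg (n : N) : Prop := ∀ u ∈ dualMonoid σ, 0 ≤ u n

theorem isNonneg_of_mem {n : N} (hn : (1 : ℝ) ⊗ₜ[ℤ] n ∈ σ) : IsNonneg (σ := σ) n := by
  intro u hu
  have := hu _ hn
  rw [realPairing_tmul] at this
  exact_mod_cast (by simpa using this : (0 : ℝ) ≤ (u n : ℝ))

variable {n : N}

theorem wt_cast (hn : IsNonneg (σ := σ) n) (i : Fin d ⊕ Fin e) :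
    (g.wt n i : ℤ) = (g.gen i : Module.Dual ℤ N) n :=
  Int.toNat_of_nonneg (hn _ (g.gen i).2)

/-- Pairing `∑ ℓ_{q,i} m_i = 0` with `n` shows that the two monomials of `F_q` have the same weight.
Nonnegativity of `n` makes `toNat` harmless. -/
theorem relWt_eq_negWt (hn : IsNonneg (σ := σ) n) (q : Fin e) :
    g.relWt n (g.rel q) = g.negWt n q := by
  have h := congrArg (fun u : Module.Dual ℤ N => u n) (g.sum_rel q)
  simp only [LinearMap.sum_apply, LinearMap.smul_apply, ← g.wt_cast hn, LinearMap.zero_apply,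
    smul_eq_mul] at h
  have h2 : ∀ j, ((-g.rel q (Sum.inr j)).toNat : ℤ) = 0 := by
    intro j
    change ((-(Pi.single q 1 : Fin e → ℤ) j).toNat : ℤ) = 0
    by_cases h : j = q
    · subst h; simp
    · simp [h]
  have h3 : (g.relWt n (g.rel q) : ℤ) - ∑ i, ((-g.rel q i).toNat : ℤ) * g.wt n i = 0 := by
    rw [relWt, Nat.cast_sum, ← Finset.sum_sub_distrib, ← h]
    refine Finset.sum_congr rfl fun i _ => ?_
    rw [Nat.cast_mul, ← sub_mul, Int.toNat_sub_toNat_neg]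
  rw [Fintype.sum_sum_type] at h3
  simp only [h2, zero_mul, Finset.sum_const_zero, add_zero] at h3
  have : (g.negWt n q : ℤ) = ∑ i, ((-g.rel q (Sum.inl i)).toNat : ℤ) * g.wt n (Sum.inl i) := by
    simp [negWt]
  rw [← this] at h3
  omega

section Solve

variable {T : Type*} [CommRing T] {I : Ideal T} {x : Fin d → PowerSeries T}

theorem hasOrderMod_posProd (hx : ∀ i, HasOrderMod I (g.wt n (Sum.inl i)) (x i)) (q : Fin e) :
    HasOrderMod I (g.posWt n q) (g.posProd q x) :=
  HasOrderMod.prod _ fun i => (hx i).pow _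

theorem hasOrderMod_negProd (hx : ∀ i, HasOrderMod I (g.wt n (Sum.inl i)) (x i)) (q : Fin e) :
    HasOrderMod I (g.negWt n q) (g.negProd q x) :=
  HasOrderMod.prod _ fun i => (hx i).pow _

/-- The low part of `z` is prescribed; the rest is `X ^ a * y`, and `y` comes from Weierstrass
division by `posProd`. -/
theorem exists_solution [IsAdicComplete I T]
    (hx : ∀ i, HasOrderMod I (g.wt n (Sum.inl i)) (x i)) (q : Fin e) (low : ℕ → T) :
    ∃ z : PowerSeries T, (∀ s < g.wt n (Sum.inr q), PowerSeries.coeff s z = low s) ∧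
      ∀ s, PowerSeries.coeff (g.relWt n (g.rel q) + s) (z * g.posProd q x - g.negProd q x) = 0 := by
  set a := g.wt n (Sum.inr q) with ha
  let z₀ : PowerSeries T := PowerSeries.mk fun s => if s < a then low s else 0
  -- The target for `y * posProd`: the defect left by `z₀`, divided by `X ^ a` with its first `a`
  -- coefficients dropped. They lie below degree `relWt`, where no equation is imposed.
  let D : PowerSeries T := PowerSeries.mk fun s =>
    PowerSeries.coeff (s + a) (g.negProd q x - z₀ * g.posProd q x)
  obtain ⟨y, hy⟩ := (g.hasOrderMod_posProd hx q).exists_coeff_mul_eq D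
  refine ⟨z₀ + PowerSeries.X ^ a * y, fun s hs => ?_, fun s => ?_⟩
  · rw [map_add, PowerSeries.coeff_X_pow_mul', if_neg (not_le.2 hs), PowerSeries.coeff_mk,
      if_pos hs, add_zero]
  · have h := hy (g.posWt n q + s) (Nat.le_add_right _ _)
    rw [PowerSeries.coeff_mk] at h
    rw [relWt_eq_add, ← ha, add_mul, mul_assoc,
      show z₀ * g.posProd q x + PowerSeries.X ^ a * (y * g.posProd q x) - g.negProd q x =
        PowerSeries.X ^ a * (y * g.posProd q x) - (g.negProd q x - z₀ * g.posProd q x) by ring,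
      map_sub, PowerSeries.coeff_X_pow_mul', if_pos (by omega),
      show a + g.posWt n q + s - a = g.posWt n q + s by omega, h,
      show g.posWt n q + s + a = a + g.posWt n q + s by omega, sub_self]

theorem solution_unique [IsAdicComplete I T]
    (hx : ∀ i, HasOrderMod I (g.wt n (Sum.inl i)) (x i)) (q : Fin e) {z z' : PowerSeries T}
    (hlow : ∀ s < g.wt n (Sum.inr q), PowerSeries.coeff s z = PowerSeries.coeff s z')
    (hz : ∀ s, PowerSeries.coeff (g.relWt n (g.rel q) + s)
      (z * g.posProd q x - g.negProd q x) = 0)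
    (hz' : ∀ s, PowerSeries.coeff (g.relWt n (g.rel q) + s)
      (z' * g.posProd q x - g.negProd q x) = 0) : z = z' := by
  set a := g.wt n (Sum.inr q) with ha
  obtain ⟨y, hy⟩ : PowerSeries.X ^ a ∣ z - z' :=
    PowerSeries.X_pow_dvd_iff.2 fun s hs => by rw [map_sub, hlow s hs, sub_self]
  have : y = 0 := by
    refine (g.hasOrderMod_posProd hx q).eq_zero_of_coeff_mul fun s hs => ?_
    obtain ⟨s, rfl⟩ := Nat.exists_eq_add_of_le hs
    have h := congrArg₂ (· - ·) (hz s) (hz' s)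
    simp only [← map_sub, sub_self] at h
    rw [sub_sub_sub_cancel_right, ← sub_mul, hy, mul_assoc, relWt_eq_add, ← ha,
      PowerSeries.coeff_X_pow_mul', if_pos (by omega),
      show a + g.posWt n q + s - a = g.posWt n q + s by omega] at h
    exact h
  rwa [this, mul_zero, sub_eq_zero] at hy

/-- Modulo `I` both terms of the equation are divisible by `X ^ relWt`; dividing by it leaves `y * u
= v` with `u` and `v` units, so `y` is a unit. -/
theorem hasOrderMod_solution (hn : IsNonneg (σ := σ) n)
    (hx : ∀ i, HasOrderMod I (g.wt n (Sum.inl i)) (x i)) (q : Fin e) {z : PowerSeries T}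
    (hlow : ∀ s < g.wt n (Sum.inr q), PowerSeries.coeff s z ∈ I)
    (hz : ∀ s, PowerSeries.coeff (g.relWt n (g.rel q) + s)
      (z * g.posProd q x - g.negProd q x) = 0) : HasOrderMod I (g.wt n (Sum.inr q)) z := by
  obtain ⟨u, hu, hP⟩ := g.hasOrderMod_posProd hx q
  obtain ⟨v, hv, hQ⟩ := g.hasOrderMod_negProd hx q
  obtain ⟨y, hy⟩ : PowerSeries.X ^ g.wt n (Sum.inr q) ∣ z.map (Ideal.Quotient.mk I) :=
    PowerSeries.X_pow_dvd_iff.2 fun s hs => by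
      rw [PowerSeries.coeff_map]; exact Ideal.Quotient.eq_zero_iff_mem.2 (hlow s hs)
  refine ⟨y, ?_, hy⟩
  have key : y * u = v := by
    ext s
    have h := congrArg (Ideal.Quotient.mk I) (hz s)
    rw [map_zero, ← PowerSeries.coeff_map, map_sub, map_mul, hP, hQ, hy,
      ← relWt_eq_negWt g hn, relWt_eq_add,
      show PowerSeries.X ^ g.wt n (Sum.inr q) * y * (PowerSeries.X ^ g.posWt n q * u) -
        PowerSeries.X ^ (g.wt n (Sum.inr q) + g.posWt n q) * v =
        PowerSeries.X ^ (g.wt n (Sum.inr q) + g.posWt n q) * (y * u - v) by ring,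
      PowerSeries.coeff_X_pow_mul', if_pos (by omega), Nat.add_sub_cancel_left, map_sub,
      sub_eq_zero] at h
    exact h
  exact isUnit_of_mul_isUnit_left (key ▸ hv)

variable [Algebra k T]

/-- A `T`-point of the arc space of the affine space whose arc has, modulo `I`, order `⟨n, m_i⟩`
in the direction `i ≤ d`, and order `≥ ⟨n, m_i⟩` in the other directions, and which satisfies the
equations `F_{q,s}` for `s ≥ ⟨n, ℓ_q⟩`. -/
structure IsTruncatedArc (n : N) (I : Ideal T)
    (φ : MvPolynomial ((Fin d ⊕ Fin e) × ℕ) k →ₐ[k] T) : Prop where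
  hasOrderMod_inl : ∀ i, HasOrderMod I (g.wt n (Sum.inl i)) (arcOf φ (Sum.inl i))
  low_mem : ∀ q, ∀ s < g.wt n (Sum.inr q), φ (MvPolynomial.X (Sum.inr q, s)) ∈ I
  apply_arcCoeff_F : ∀ q s, φ (arcCoeff (g.F k q) (g.relWt n (g.rel q) + s)) = 0

namespace IsTruncatedArc

variable {g} {φ ψ : MvPolynomial ((Fin d ⊕ Fin e) × ℕ) k →ₐ[k] T}

theorem map {T' : Type*} [CommRing T'] [Algebra k T'] {I' : Ideal T'}
    (h : g.IsTruncatedArc n I φ) (f : T →ₐ[k] T') (hf : I ≤ I'.comap f) :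
    g.IsTruncatedArc n I' (f.comp φ) where
  hasOrderMod_inl i := by
    rw [arcOf_comp]
    exact (h.hasOrderMod_inl i).map _ hf
  low_mem q s hs := hf (h.low_mem q s hs)
  apply_arcCoeff_F q s := by rw [AlgHom.comp_apply, h.apply_arcCoeff_F, map_zero]

theorem hasOrderMod (hn : IsNonneg (σ := σ) n) (h : g.IsTruncatedArc n I φ) (i : Fin d ⊕ Fin e) :
    HasOrderMod I (g.wt n i) (arcOf φ i) := by
  rcases i with i | q
  · exact h.hasOrderMod_inl i
  · refine g.hasOrderMod_solution hn h.hasOrderMod_inl q (fun s hs => ?_) fun s => ?_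
    · rw [coeff_arcOf]; exact h.low_mem q s hs
    · rw [← aeval_F (k := k), ← apply_arcCoeff]; exact h.apply_arcCoeff_F q s

/-- Rigidity of truncated arcs: the free data are the arcs in the directions `i ≤ d` and the low
coefficients of the others, since `solution_unique` determines the remaining coefficients. -/
theorem ext [IsAdicComplete I T] (hφ : g.IsTruncatedArc n I φ) (hψ : g.IsTruncatedArc n I ψ)
    (hlow : ∀ i s, s < g.wt n i → φ (MvPolynomial.X (i, s)) = ψ (MvPolynomial.X (i, s)))
    (hhigh : ∀ i s, g.wt n (Sum.inl i) ≤ s →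
      φ (MvPolynomial.X (Sum.inl i, s)) = ψ (MvPolynomial.X (Sum.inl i, s))) : φ = ψ := by
  have hl : ∀ i, arcOf φ (Sum.inl i) = arcOf ψ (Sum.inl i) := by
    intro i
    ext s
    rw [coeff_arcOf, coeff_arcOf]
    exact (lt_or_ge s _).elim (hlow _ s) (hhigh i s)
  have hr : ∀ q, arcOf φ (Sum.inr q) = arcOf ψ (Sum.inr q) := by
    intro q
    refine g.solution_unique hφ.hasOrderMod_inl q (fun s hs => ?_) (fun s => ?_) fun s => ?_
    · rw [coeff_arcOf, coeff_arcOf]; exact hlow _ s hs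
    · rw [← aeval_F (k := k), ← apply_arcCoeff]; exact hφ.apply_arcCoeff_F q s
    · simp only [hl]
      rw [← aeval_F (k := k), ← apply_arcCoeff]; exact hψ.apply_arcCoeff_F q s
  apply MvPolynomial.algHom_ext
  rintro ⟨i | q, s⟩
  · rw [← coeff_arcOf, ← coeff_arcOf, hl]
  · rw [← coeff_arcOf, ← coeff_arcOf, hr]

end IsTruncatedArc

theorem exists_isTruncatedArc [IsAdicComplete I T]
    (hx : ∀ i, HasOrderMod I (g.wt n (Sum.inl i)) (x i)) (low : Fin e → ℕ → T)
    (hlow : ∀ q, ∀ s < g.wt n (Sum.inr q), low q s ∈ I) :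
    ∃ φ : MvPolynomial ((Fin d ⊕ Fin e) × ℕ) k →ₐ[k] T, g.IsTruncatedArc n I φ ∧
      (∀ i s, φ (MvPolynomial.X (Sum.inl i, s)) = PowerSeries.coeff s (x i)) ∧
      ∀ q, ∀ s < g.wt n (Sum.inr q), φ (MvPolynomial.X (Sum.inr q, s)) = low q s := by
  choose z hz₁ hz₂ using fun q => g.exists_solution hx q (low q)
  let φ : MvPolynomial ((Fin d ⊕ Fin e) × ℕ) k →ₐ[k] T :=
    MvPolynomial.aeval fun p => PowerSeries.coeff p.2 (Sum.elim x z p.1)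
  have hφ : arcOf φ = Sum.elim x z := by
    ext i s
    simp [φ]
  refine ⟨φ, ⟨fun i => ?_, fun q s hs => ?_, fun q s => ?_⟩, fun i s => ?_, fun q s hs => ?_⟩
  · rw [hφ]; exact hx i
  · simpa [φ, hz₁ q s hs] using hlow q s hs
  · rw [apply_arcCoeff, hφ, aeval_F]
    exact hz₂ q s
  · simp [φ]
  · simp [φ, hz₁ q s hs]

end Solve

end Generators

theorem hasOrderMod_bot_iff {T : Type*} [CommRing T] {p : ℕ} {P : PowerSeries T} :
    HasOrderMod ⊥ p P ↔ ∃ u : (PowerSeries T)ˣ, P = PowerSeries.X ^ p * (u : PowerSeries T) := by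
  constructor
  · intro hP
    obtain ⟨y, hy⟩ : PowerSeries.X ^ p ∣ P :=
      PowerSeries.X_pow_dvd_iff.2 fun s hs => by simpa using hP.coeff_mem hs
    have h := hP.isUnit_coeff
    rw [hy, PowerSeries.coeff_X_pow_mul', if_pos le_rfl, Nat.sub_self,
      PowerSeries.coeff_zero_eq_constantCoeff_apply, ← PowerSeries.isUnit_iff_constantCoeff] at h
    exact ⟨h.unit, hy⟩
  · rintro ⟨u, rfl⟩
    exact ⟨_, u.isUnit.map (PowerSeries.map (Ideal.Quotient.mk ⊥)), by simp⟩

/-! ### Laurent monomials: comparison of `V_σ` with `W`, and orders along an arc. -/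

namespace Generators

variable {N : Type*} [AddCommGroup N] {σ : PointedCone ℝ (ℝ ⊗[ℤ] N)} {d e : ℕ}
  (g : Generators σ d e) {n : N} {k : Type*} [Field k]

/-- The Laurent monomial `m ↦ ∏ u_i ^ (m_i)`, in the coordinates `m_i` of the basis. -/
def laurent {G : Type*} [CommGroup G] (u : Fin d → G) : Multiplicative (Module.Dual ℤ N) →* G where
  toFun m := ∏ i, u i ^ g.basis.repr m.toAdd i
  map_one' := by simp
  map_mul' a b := by simp [zpow_add, Finset.prod_mul_distrib]

theorem laurent_basis {G : Type*} [CommGroup G] (u : Fin d → G) (i : Fin d) :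
    g.laurent u (Multiplicative.ofAdd (g.gen (Sum.inl i) : Module.Dual ℤ N)) = u i := by
  classical
  change ∏ j, u j ^ g.basis.repr (g.gen (Sum.inl i) : Module.Dual ℤ N) j = u i
  rw [← g.basis_eq, g.basis.repr_self, Finset.prod_eq_single i]
  · simp
  · intro j _ hj
    simp [hj.symm]
  · simp

theorem map_laurent {G H : Type*} [CommGroup G] [CommGroup H] (f : G →* H) (u : Fin d → G)
    (m : Multiplicative (Module.Dual ℤ N)) :
    f (g.laurent u m) = g.laurent (fun i => f (u i)) m := by
  change f (∏ i, u i ^ _) = ∏ i, f (u i) ^ _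
  simp [map_prod]

/-- The value of `h` at `m_q` and `x_q` solve the same linear equation `F_q = 0`, whose coefficient
`posProd` is a nonzerodivisor, so they coincide. -/
theorem lift_chi_eq_aeval {B : Type*} [CommRing B] [Algebra k B]
    (h : Multiplicative (dualMonoid σ) →* B) (x : Fin d ⊕ Fin e → B)
    (hx : ∀ i, h (Multiplicative.ofAdd (g.gen (Sum.inl i))) = x (Sum.inl i))
    (hreg : ∀ q, g.posProd q (fun i => x (Sum.inl i)) ∈ nonZeroDivisors B)
    (hF : ∀ q, MvPolynomial.aeval x (g.F k q) = 0) (F : MvPolynomial (Fin d ⊕ Fin e) k) :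
    AddMonoidAlgebra.lift k B _ h (g.chi k F) = MvPolynomial.aeval x F := by
  have h1 : (AddMonoidAlgebra.lift k B _ h).comp (g.chi k) =
      MvPolynomial.aeval fun i => h (Multiplicative.ofAdd (g.gen i)) := by
    apply MvPolynomial.algHom_ext
    intro i
    simp [chi]
  have h2 : (fun i => h (Multiplicative.ofAdd (g.gen i))) = x := by
    funext i
    rcases i with i | q
    · exact hx i
    · have h3 : MvPolynomial.aeval (fun i => h (Multiplicative.ofAdd (g.gen i))) (g.F k q) = 0 := by
        rw [← h1, AlgHom.comp_apply,
          show g.chi k (g.F k q) = 0 from g.ciIdeal_le k (Ideal.subset_span ⟨q, rfl⟩), map_zero]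
      have h4 := hF q
      rw [aeval_F] at h3 h4
      simp only [hx] at h3
      refine mul_cancel_right_mem_nonZeroDivisors (hreg q) |>.1 ?_
      rw [sub_eq_zero.1 h3, sub_eq_zero.1 h4]
  rw [← h2, ← h1, AlgHom.comp_apply]

theorem toricIdeal_le_ker_aeval {B : Type*} [CommRing B] [Algebra k B] (x : Fin d ⊕ Fin e → B)
    (hx : ∀ i, x (Sum.inl i) ∈ nonZeroDivisors B)
    (hF : g.ciIdeal k ≤ RingHom.ker (MvPolynomial.aeval (R := k) x)) :
    g.toricIdeal k ≤ RingHom.ker (MvPolynomial.aeval (R := k) x) := by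
  intro G hG
  let U := FractionRing B
  have hu : ∀ i, IsUnit (algebraMap B U (x (Sum.inl i))) :=
    fun i => IsLocalization.map_units U (⟨_, hx i⟩ : nonZeroDivisors B)
  -- In the total fraction ring the `x_i`, `i ≤ d`, are units, so Laurent monomials in them define a
  -- character of all of `M`, here restricted to `S_σ`.
  let h : Multiplicative (dualMonoid σ) →* U :=
    (Units.coeHom U).comp ((g.laurent fun i => (hu i).unit).comp
      (AddMonoidHom.toMultiplicative (dualMonoid σ).subtype))
  have hmap : ∀ F : MvPolynomial (Fin d ⊕ Fin e) k,
      MvPolynomial.aeval (fun i => algebraMap B U (x i)) F =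
        algebraMap B U (MvPolynomial.aeval x F) := by
    intro F
    exact MvPolynomial.aeval_algebraMap_apply U x F
  have key := g.lift_chi_eq_aeval (k := k) h (fun i => algebraMap B U (x i)) (fun i => ?_)
    (fun q => ?_) (fun q => ?_) G
  · rw [show g.chi k G = 0 from hG, map_zero, hmap] at key
    exact IsLocalization.injective U (le_refl (nonZeroDivisors B)) (by rw [← key, map_zero])
  · change ((g.laurent (fun i => (hu i).unit)
      (Multiplicative.ofAdd (g.gen (Sum.inl i) : Module.Dual ℤ N)) : Uˣ) : U) = _
    rw [laurent_basis, IsUnit.unit_spec]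
  · rw [← map_posProd]
    have hmem : g.posProd q (fun i => x (Sum.inl i)) ∈ nonZeroDivisors B :=
      Submonoid.prod_mem _ fun i _ => pow_mem (hx i) _
    exact (IsLocalization.map_units U (⟨_, hmem⟩ : nonZeroDivisors B)).mem_nonZeroDivisors
  · rw [hmap, show MvPolynomial.aeval x (g.F k q) = 0 from
      hF (Ideal.subset_span ⟨q, rfl⟩), map_zero]

/-- A truncated arc which satisfies the equations of `W` satisfies those of `V_σ`. -/
theorem IsTruncatedArc.toricIdeal_le {g : Generators σ d e} {T : Type*} [CommRing T] [Algebra k T]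
    {I : Ideal T} [IsAdicComplete I T] {φ : MvPolynomial ((Fin d ⊕ Fin e) × ℕ) k →ₐ[k] T}
    (h : g.IsTruncatedArc n I φ) (hφ : arcIdeal (g.ciIdeal k) ≤ RingHom.ker φ) :
    arcIdeal (g.toricIdeal k) ≤ RingHom.ker φ := by
  rw [arcIdeal_le_ker_iff] at hφ ⊢
  exact g.toricIdeal_le_ker_aeval _ (fun i => (h.hasOrderMod_inl i).mem_nonZeroDivisors) hφ

/-- A truncated arc modulo the zero ideal is an arc of `W`. -/
theorem IsTruncatedArc.ciIdeal_le {g : Generators σ d e} {T : Type*} [CommRing T] [Algebra k T]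
    (hn : IsNonneg (σ := σ) n) {φ : MvPolynomial ((Fin d ⊕ Fin e) × ℕ) k →ₐ[k] T}
    (h : g.IsTruncatedArc n ⊥ φ) : arcIdeal (g.ciIdeal k) ≤ RingHom.ker φ := by
  rw [arcIdeal_le_ker_iff, Generators.ciIdeal, Ideal.span_le]
  rintro _ ⟨q, rfl⟩
  change MvPolynomial.aeval _ _ = 0
  ext s
  rw [map_zero]
  -- Only the equations below degree `relWt` are missing. There both monomials vanish, as the orders
  -- are now exact and not only modulo an ideal.
  rcases lt_or_ge s (g.relWt n (g.rel q)) with hs | hs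
  · rw [aeval_F, map_sub]
    have h1 := ((h.hasOrderMod hn (Sum.inr q)).mul
      (g.hasOrderMod_posProd h.hasOrderMod_inl q)).coeff_mem (s := s)
        (by rwa [← relWt_eq_add])
    have h2 := (g.hasOrderMod_negProd h.hasOrderMod_inl q).coeff_mem (s := s)
        (by rwa [← relWt_eq_negWt g hn])
    rw [(Submodule.mem_bot _).1 h1, (Submodule.mem_bot _).1 h2, sub_zero]
  · obtain ⟨s, rfl⟩ := Nat.exists_eq_add_of_le hs
    rw [← apply_arcCoeff, h.apply_arcCoeff_F]

theorem laurent_linearIndependent {L : Type*} [Field L] [Algebra k L] (u : Fin d → Lˣ)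
    (hu : AlgebraicIndependent k fun i => (u i : L)) (s : Finset (dualMonoid σ))
    (b : dualMonoid σ → k)
    (hb : ∑ m ∈ s, b m • ((g.laurent u (Multiplicative.ofAdd (m : Module.Dual ℤ N)) : Lˣ) : L) = 0) :
    ∀ m ∈ s, b m = 0 := by
  classical
  let r : dualMonoid σ → Fin d → ℤ := fun m i => g.basis.repr (m : Module.Dual ℤ N) i
  -- A bound for all exponents: multiplication by `∏ u_i ^ M` turns the Laurent monomials into
  -- distinct ordinary monomials.
  let M : ℕ := ∑ m ∈ s, ∑ i, (r m i).natAbs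
  have hM : ∀ m ∈ s, ∀ i, 0 ≤ r m i + M := by
    intro m hm i
    have h1 : (r m i).natAbs ≤ ∑ i, (r m i).natAbs :=
      Finset.single_le_sum (f := fun i => (r m i).natAbs) (fun _ _ => Nat.zero_le _)
        (Finset.mem_univ i)
    have h2 : ∑ i, (r m i).natAbs ≤ M :=
      Finset.single_le_sum (f := fun m => ∑ i, (r m i).natAbs) (fun _ _ => Nat.zero_le _) hm
    omega
  let E : dualMonoid σ → Fin d →₀ ℕ := fun m =>
    Finsupp.equivFunOnFinite.symm fun i => (r m i + M).toNat
  have hE : ∀ m ∈ s, ∀ m' ∈ s, E m = E m' → m = m' := by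
    intro m hm m' hm' h
    apply Subtype.ext
    apply g.basis.repr.injective
    ext i
    have h1 : (r m i + M).toNat = (r m' i + M).toNat := DFunLike.congr_fun h i
    have := hM m hm i
    have := hM m' hm' i
    change r m i = r m' i
    omega
  have hmon : ∀ m ∈ s, ∏ i, (u i : L) ^ E m i =
      ((g.laurent u (Multiplicative.ofAdd (m : Module.Dual ℤ N)) : Lˣ) : L) *
        ∏ i, (u i : L) ^ M := by
    intro m hm
    change _ = ((∏ i, u i ^ r m i : Lˣ) : L) * _
    rw [Units.coe_prod, ← Finset.prod_mul_distrib]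
    refine Finset.prod_congr rfl fun i _ => ?_
    rw [Units.val_zpow_eq_zpow_val, ← zpow_natCast, ← zpow_natCast, ← zpow_add₀ (u i).ne_zero]
    congr 1
    exact Int.toNat_of_nonneg (hM m hm i)
  let p : MvPolynomial (Fin d) k := ∑ m ∈ s, MvPolynomial.monomial (E m) (b m)
  have hp : MvPolynomial.aeval (fun i => (u i : L)) p = 0 := by
    rw [map_sum]
    have : ∀ m ∈ s, MvPolynomial.aeval (fun i => (u i : L)) (MvPolynomial.monomial (E m) (b m)) =
        (b m • ((g.laurent u (Multiplicative.ofAdd (m : Module.Dual ℤ N)) : Lˣ) : L)) *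
          ∏ i, (u i : L) ^ M := by
      intro m hm
      rw [MvPolynomial.aeval_monomial, Finsupp.prod_fintype _ _ (by simp), hmon m hm,
        Algebra.smul_def, mul_assoc]
    rw [Finset.sum_congr rfl this, ← Finset.sum_mul, hb, zero_mul]
  have hp0 : p = 0 := (injective_iff_map_eq_zero _).1 hu p hp
  intro m hm
  have := congrArg (MvPolynomial.coeff (E m)) hp0
  rw [MvPolynomial.coeff_sum, MvPolynomial.coeff_zero, Finset.sum_eq_single m] at this
  · simpa using this
  · intro m' hm' hne
    rw [MvPolynomial.coeff_monomial, if_neg fun h => hne (hE _ hm' _ hm h)]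
  · exact fun h => absurd hm h

/-- The arc sends `χ^m` to `t ^ ⟨n, m⟩` times a Laurent monomial in units. The coefficient of lowest
possible degree is a combination of distinct Laurent monomials in algebraically independent
elements, hence is nonzero. -/
theorem order_aeval_arcOf {L : Type*} [Field L] [Algebra k L] (hn : IsNonneg (σ := σ) n)
    {φ : MvPolynomial ((Fin d ⊕ Fin e) × ℕ) k →ₐ[k] L} (h : g.IsTruncatedArc n ⊥ φ)
    (hu : AlgebraicIndependent k fun i =>
      φ (MvPolynomial.X (Sum.inl i, g.wt n (Sum.inl i))))
    (F : MvPolynomial (Fin d ⊕ Fin e) k) :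
    (MvPolynomial.aeval (arcOf φ) F).order = toricOrd k n (g.chi k F) := by
  classical
  choose w hw using fun i => hasOrderMod_bot_iff.1 (h.hasOrderMod_inl i)
  let wt : dualMonoid σ → ℕ := fun m => ((m : Module.Dual ℤ N) n).toNat
  let H : Multiplicative (dualMonoid σ) →* PowerSeries L :=
    { toFun := fun m => PowerSeries.X ^ wt m.toAdd *
        ((g.laurent w (Multiplicative.ofAdd (m.toAdd : Module.Dual ℤ N)) :
          (PowerSeries L)ˣ) : PowerSeries L)
      map_one' := by
        simp [wt]
      map_mul' := fun a b => by
        have : wt (a * b).toAdd = wt a.toAdd + wt b.toAdd :=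
          Int.toNat_add (hn _ a.toAdd.2) (hn _ b.toAdd.2)
        rw [this, toAdd_mul, AddSubmonoid.coe_add, ofAdd_add, map_mul, Units.val_mul]
        ring }
  have hH : ∀ m s, PowerSeries.coeff s (H (Multiplicative.ofAdd m)) = if wt m ≤ s then
      PowerSeries.coeff (s - wt m) ((g.laurent w (Multiplicative.ofAdd (m : Module.Dual ℤ N)) :
          (PowerSeries L)ˣ) : PowerSeries L) else 0 := by
    intro m s
    exact PowerSeries.coeff_X_pow_mul' _ _ _
  let u : Fin d → Lˣ := fun i => Units.map (PowerSeries.constantCoeff (R := L)).toMonoidHom (w i)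
  have hc : ∀ i, (u i : L) = φ (MvPolynomial.X (Sum.inl i, g.wt n (Sum.inl i))) := by
    intro i
    rw [← coeff_arcOf, hw, PowerSeries.coeff_X_pow_mul', if_pos le_rfl, Nat.sub_self]
    simp [u]
  have hconst : ∀ m : dualMonoid σ, PowerSeries.constantCoeff
      ((g.laurent w (Multiplicative.ofAdd (m : Module.Dual ℤ N)) :
        (PowerSeries L)ˣ) : PowerSeries L) =
      ((g.laurent u (Multiplicative.ofAdd (m : Module.Dual ℤ N)) : Lˣ) : L) := by
    intro m
    rw [← g.map_laurent (Units.map (PowerSeries.constantCoeff (R := L)).toMonoidHom)]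
    rfl
  have hF : ∀ q, MvPolynomial.aeval (arcOf φ) (g.F k q) = 0 := fun q =>
    (arcIdeal_le_ker_iff _ _).1 (h.ciIdeal_le hn) (Ideal.subset_span ⟨q, rfl⟩)
  have key := g.lift_chi_eq_aeval (k := k) H (arcOf φ) (fun i => ?_) (fun q => ?_) hF F
  swap
  · rw [hw]
    change PowerSeries.X ^ wt (g.gen (Sum.inl i)) * ((g.laurent w (Multiplicative.ofAdd
      (g.gen (Sum.inl i) : Module.Dual ℤ N)) : (PowerSeries L)ˣ) : PowerSeries L) = _
    rw [laurent_basis]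
    rfl
  swap
  · exact (g.hasOrderMod_posProd h.hasOrderMod_inl q).mem_nonZeroDivisors
  rw [← key]
  generalize g.chi k F = f
  rw [AddMonoidAlgebra.lift_apply, Finsupp.sum, toricOrd]
  change _ = ⨅ m ∈ f.coeff.support, ((wt m : ℕ) : ℕ∞)
  rcases f.coeff.support.eq_empty_or_nonempty with h0 | h0
  · simp [h0]
  obtain ⟨m₀, hm₀, hmin⟩ := Finset.exists_min_image _ wt h0
  have hinf : (⨅ m ∈ f.coeff.support, ((wt m : ℕ) : ℕ∞)) = wt m₀ :=
    le_antisymm (iInf₂_le m₀ hm₀) (le_iInf₂ fun m hm => by exact_mod_cast hmin m hm)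
  rw [hinf, PowerSeries.order_eq_nat]
  constructor
  · intro hz
    have hz' : ∑ m ∈ f.coeff.support with wt m = wt m₀,
        f.coeff m • ((g.laurent u (Multiplicative.ofAdd (m : Module.Dual ℤ N)) : Lˣ) : L) = 0 := by
      rw [← hz, map_sum, Finset.sum_filter]
      refine Finset.sum_congr rfl fun m hm => ?_
      rw [PowerSeries.coeff_smul, hH]
      split_ifs with h1 h2 h2
      · rw [h1, Nat.sub_self, PowerSeries.coeff_zero_eq_constantCoeff_apply, hconst]
      · omega
      · exact absurd (le_antisymm h2 (hmin m hm)) h1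
      · rw [smul_zero]
    have := g.laurent_linearIndependent u (by simpa only [hc] using hu) _ _ hz' m₀ (by simp [hm₀])
    exact Finsupp.mem_support_iff.1 hm₀ this
  · intro s hs
    rw [map_sum]
    refine Finset.sum_eq_zero fun m hm => ?_
    rw [PowerSeries.coeff_smul, hH, if_neg (by have := hmin m hm; omega), smul_zero]

end Generators

/-! ### Recognizing a completion without noetherian hypotheses. -/

section Completion

theorem isAdicComplete_of_pow_eq_bot {T : Type*} [CommRing T] {J : Ideal T} {n : ℕ}
    (hJ : J ^ n = ⊥) : IsAdicComplete J T where
  haus' x hx := by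
    have := hx n
    rwa [hJ, Submodule.bot_smul, SModEq.bot] at this
  prec' f hf := by
    refine ⟨f n, fun m => ?_⟩
    rcases le_total m n with h | h
    · exact hf h
    · have := hf h
      rw [hJ, Submodule.bot_smul, SModEq.bot] at this
      rw [this]

/-- Precompleteness is surjectivity of the map to the completion, and completion preserves
surjections. -/
theorem isPrecomplete_quotient {R : Type*} [CommRing R] (I J : Ideal R) [IsPrecomplete I R] :
    IsPrecomplete (I.map (Ideal.Quotient.mk J)) (R ⧸ J) := by
  have h : IsPrecomplete I (R ⧸ J) := by
    rw [← AdicCompletion.of_surjective_iff]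
    intro y
    obtain ⟨x, rfl⟩ := AdicCompletion.map_surjective I (f := J.mkQ) J.mkQ_surjective y
    obtain ⟨r, rfl⟩ := AdicCompletion.of_surjective I R x
    exact ⟨J.mkQ r, (AdicCompletion.map_of I _ r).symm⟩
  exact (IsPrecomplete.map_algebraMap_iff (I := I) (S := R ⧸ J)).2 h

/-- Successive approximation: the `n`-th power of the extended ideal is generated by images of `m ^
n`, and the coefficients of a combination of these may be replaced by images from `O`, at the cost
of one more power. -/
theorem exists_sub_mem_pow {O S : Type*} [CommRing O] [CommRing S] (m : Ideal O) (Θ : O →+* S)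
    (hS : ∀ s, ∃ o, s - Θ o ∈ m.map Θ) (n : ℕ) (s : S) : ∃ o, s - Θ o ∈ (m.map Θ) ^ n := by
  induction n with
  | zero => exact ⟨0, by simp⟩
  | succ n ih =>
    suffices h : ∀ t ∈ (m.map Θ) ^ n, ∃ o, t - Θ o ∈ (m.map Θ) ^ (n + 1) by
      obtain ⟨o, ho⟩ := ih
      obtain ⟨o', ho'⟩ := h _ ho
      exact ⟨o + o', by rwa [map_add, ← sub_sub]⟩
    intro t ht
    rw [← Ideal.map_pow, Ideal.map] at ht
    induction ht using Submodule.span_induction with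
    | mem x hx =>
      obtain ⟨o, -, rfl⟩ := hx
      exact ⟨o, by simp⟩
    | zero => exact ⟨0, by simp⟩
    | add x y _ _ hx hy =>
      obtain ⟨a, ha⟩ := hx
      obtain ⟨b, hb⟩ := hy
      exact ⟨a + b, by rw [map_add, add_sub_add_comm]; exact add_mem ha hb⟩
    | smul c x hx' hx =>
      obtain ⟨a, ha⟩ := hx
      obtain ⟨b, hb⟩ := hS c
      refine ⟨b * a, ?_⟩
      have hx'' : x ∈ (m.map Θ) ^ n := by rwa [← Ideal.map_pow]
      rw [smul_eq_mul, map_mul,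
        show c * x - Θ b * Θ a = (c - Θ b) * x + Θ b * (x - Θ a) by ring]
      refine add_mem ?_ (Ideal.mul_mem_left _ _ ha)
      rw [pow_succ']
      exact Ideal.mul_mem_mul hb hx''

/-- A criterion for a complete ring `S` to be the completion of `O`. -/
theorem nonempty_adicCompletion_algEquiv {k O S : Type*} [CommRing k] [CommRing O] [Algebra k O]
    [CommRing S] [Algebra k S] (m : Ideal O) (Θ : O →ₐ[k] S) (Φ : ∀ n : ℕ, S →ₐ[k] O ⧸ m ^ n)
    [IsAdicComplete (m.map (Θ : O →+* S)) S]
    (hΦ : ∀ n o, Φ n (Θ o) = Ideal.Quotient.mk (m ^ n) o)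
    (hS : ∀ s, ∃ o, s - Θ o ∈ m.map (Θ : O →+* S)) :
    Nonempty (AdicCompletion m O ≃ₐ[k] S) := by
  set M := m.map (Θ : O →+* S) with hM
  have hdense := exists_sub_mem_pow m (Θ : O →+* S) hS
  have hker : ∀ n, ∀ s ∈ M ^ n, Φ n s = 0 := by
    intro n s hs
    have : M ^ n ≤ RingHom.ker (Φ n) := by
      rw [hM, ← Ideal.map_pow, Ideal.map_le_iff_le_comap]
      intro o ho
      change Φ n (Θ o) = 0
      rw [hΦ]
      exact Ideal.Quotient.eq_zero_iff_mem.2 ho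
    exact this hs
  have hval : ∀ n s o, s - Θ o ∈ M ^ n → Φ n s = Ideal.Quotient.mk (m ^ n) o := by
    intro n s o h
    have := hker n _ h
    rwa [map_sub, hΦ, sub_eq_zero] at this
  -- With `hker`, the kernel of `Φ n` is exactly `M ^ n`; this gives injectivity of `Ψ`, as `S` is
  -- Hausdorff.
  have hker' : ∀ n s, Φ n s = 0 → s ∈ M ^ n := by
    intro n s h
    obtain ⟨o, ho⟩ := hdense n s
    have ho' : o ∈ m ^ n := by
      rw [← Ideal.Quotient.eq_zero_iff_mem, ← hval n s o ho, h]
    rw [← sub_add_cancel s (Θ o)]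
    refine add_mem ho ?_
    rw [hM, ← Ideal.map_pow]
    exact Ideal.mem_map_of_mem (Θ : O →+* S) ho'
  -- Compatibility of the `Φ n` is not assumed: it follows from density of the image of `O`, on
  -- which they are prescribed.
  let Ψ : S →ₐ[k] AdicCompletion m O := AdicCompletion.liftAlgHom m Φ (by
    intro a b hab
    ext s
    obtain ⟨o, ho⟩ := hdense b s
    rw [AlgHom.comp_apply, hval b s o ho, hval a s o (Ideal.pow_le_pow_right hab ho)]
    rfl)
  have hΨ : ∀ n s, AdicCompletion.evalₐ m n (Ψ s) = Φ n s := fun n s =>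
    AdicCompletion.evalₐ_liftAlgHom _ _ _ n s
  refine ⟨(AlgEquiv.ofBijective Ψ ⟨?_, ?_⟩).symm⟩
  · rw [injective_iff_map_eq_zero]
    intro s hs
    refine IsHausdorff.haus (inferInstance : IsHausdorff M S) s fun n => ?_
    rw [SModEq.zero, smul_eq_mul, Ideal.mul_top]
    refine hker' n s ?_
    rw [← hΨ, hs, map_zero]
  · intro x
    obtain ⟨a, rfl⟩ := AdicCompletion.mk_surjective m O x
    obtain ⟨s, hs⟩ := IsPrecomplete.prec (inferInstance : IsPrecomplete M S)
      (f := fun n => Θ (a.val n)) (by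
        intro i j hij
        have h := a.2 hij
        rw [SModEq.sub_mem, smul_eq_mul, Ideal.mul_top] at h ⊢
        rw [← map_sub, hM, ← Ideal.map_pow]
        exact Ideal.mem_map_of_mem (Θ : O →+* S) h)
    refine ⟨s, AdicCompletion.ext_evalₐ fun n => ?_⟩
    rw [hΨ, AdicCompletion.evalₐ_mk]
    refine hval n s _ ?_
    have h := (hs n).symm
    rwa [SModEq.sub_mem, smul_eq_mul, Ideal.mul_top] at h

end Completion

/-! ### Power series in finitely many variables. -/

section MvPowerSeries

variable {V L : Type*} [CommRing L]

theorem mem_span_X_of_constantCoeff_eq_zero [Finite V] {f : MvPowerSeries V L}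
    (hf : MvPowerSeries.constantCoeff f = 0) :
    f ∈ Ideal.span (Set.range (MvPowerSeries.X : V → MvPowerSeries V L)) := by
  classical
  have := Fintype.ofFinite V
  have hpick : ∀ m : V →₀ ℕ, m ≠ 0 → ∃ v, m v ≠ 0 := fun m hm => by
    by_contra! h
    exact hm (Finsupp.ext h)
  rcases isEmpty_or_nonempty V with hV | hV
  · have : f = 0 := by
      ext m
      rw [Subsingleton.elim m 0, MvPowerSeries.coeff_zero_eq_constantCoeff_apply, hf, map_zero]
    exact this ▸ zero_mem _
  choose! pick hpick using hpick
  -- Each nonconstant monomial is charged to one chosen variable dividing it, so that `f = ∑ c v * X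
  -- v` counts it once.
  let c : V → MvPowerSeries V L := fun v m =>
    if pick (m + Finsupp.single v 1) = v then MvPowerSeries.coeff (m + Finsupp.single v 1) f else 0
  have h : f = ∑ v, c v * MvPowerSeries.X v := by
    ext m
    rw [map_sum]
    have hc : ∀ v, MvPowerSeries.coeff m (c v * MvPowerSeries.X v) =
        if Finsupp.single v 1 ≤ m ∧ pick m = v then MvPowerSeries.coeff m f else 0 := by
      intro v
      rw [MvPowerSeries.X, MvPowerSeries.coeff_mul_monomial, mul_one]
      by_cases hv : Finsupp.single v 1 ≤ m
      · rw [if_pos hv]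
        change (if pick (m - Finsupp.single v 1 + Finsupp.single v 1) = v then _ else _) = _
        rw [tsub_add_cancel_of_le hv]
        simp [hv]
      · simp [hv]
    simp only [hc]
    by_cases hm : m = 0
    · subst hm
      rw [MvPowerSeries.coeff_zero_eq_constantCoeff_apply, hf]
      simp
    · rw [Finset.sum_eq_single (pick m)]
      · rw [if_pos ⟨Finsupp.single_le_iff.2 (Nat.one_le_iff_ne_zero.2 (hpick m hm)), rfl⟩]
      · intro v _ hv
        rw [if_neg fun h => hv h.2.symm]
      · simp
  rw [h]
  exact Ideal.sum_mem _ fun v _ => Ideal.mul_mem_left _ _ (Ideal.subset_span ⟨v, rfl⟩)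

theorem span_X_eq_ker_constantCoeff [Finite V] :
    Ideal.span (Set.range (MvPowerSeries.X : V → MvPowerSeries V L)) =
      RingHom.ker (MvPowerSeries.constantCoeff (σ := V) (R := L)) := by
  refine le_antisymm (Ideal.span_le.2 ?_) fun f hf => mem_span_X_of_constantCoeff_eq_zero hf
  rintro _ ⟨v, rfl⟩
  exact MvPowerSeries.constantCoeff_X v

theorem maximalIdeal_eq_span_X [Finite V] {L : Type*} [Field L] :
    IsLocalRing.maximalIdeal (MvPowerSeries V L) =
      Ideal.span (Set.range (MvPowerSeries.X : V → MvPowerSeries V L)) := by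
  ext f
  rw [span_X_eq_ker_constantCoeff, RingHom.mem_ker, IsLocalRing.mem_maximalIdeal, mem_nonunits_iff,
    MvPowerSeries.isUnit_iff_constantCoeff, isUnit_iff_ne_zero, not_not]

/-- Evaluation of power series at nilpotent elements. -/
theorem exists_ringHom_of_pow_eq_bot [Finite V] {T : Type*} [CommRing T] (f : L →+* T) (a : V → T)
    {J : Ideal T} (ha : ∀ v, a v ∈ J) {n : ℕ} (hJ : J ^ n = ⊥) :
    ∃ φ : MvPowerSeries V L →+* T, (∀ c, φ (MvPowerSeries.C c) = f c) ∧
      ∀ v, φ (MvPowerSeries.X v) = a v := by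
  let ψ : MvPolynomial V L →+* T := MvPolynomial.eval₂Hom f a
  -- Evaluation of polynomials kills degrees at least `n`, so it extends to series through
  -- truncation.
  have hψ : ∀ p ∈ MvPolynomial.idealOfVars V L ^ n, ψ p = 0 := by
    have h : MvPolynomial.idealOfVars V L ≤ J.comap ψ := by
      rw [MvPolynomial.idealOfVars, Ideal.span_le]
      rintro _ ⟨v, rfl⟩
      simpa [ψ] using ha v
    intro p hp
    have h' := (Ideal.le_comap_pow ψ n) (Ideal.pow_right_mono h n hp)
    rw [hJ] at h'
    exact h'
  let t := MvPowerSeries.truncTotalAlgHom V L n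
  have ht : ∀ p : MvPolynomial V L, t (p : MvPowerSeries V L) = Ideal.Quotient.mk _ p :=
    fun p => t.commutes p
  refine ⟨(Ideal.Quotient.lift _ ψ hψ).comp (t : MvPowerSeries V L →+* _), fun c => ?_, fun v => ?_⟩
  · have := ht (MvPolynomial.C c)
    rw [MvPolynomial.coe_C] at this
    rw [RingHom.comp_apply, RingHom.coe_coe, this, Ideal.Quotient.lift_mk]
    exact MvPolynomial.eval₂Hom_C f a c
  · have := ht (MvPolynomial.X v)
    rw [MvPolynomial.coe_X] at this
    rw [RingHom.comp_apply, RingHom.coe_coe, this, Ideal.Quotient.lift_mk]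
    exact MvPolynomial.eval₂Hom_X' f a v

end MvPowerSeries

/-! ### The morphism `ε`, the generic arc, and the ring `R/⟨ε([j])⟩`. -/

namespace Generators

variable {N : Type*} [AddCommGroup N] {σ : PointedCone ℝ (ℝ ⊗[ℤ] N)} {d e : ℕ}
  (g : Generators σ d e) (n : N) (k : Type*) [Field k]

/-- The polynomial ring `k[Z_{i,s} ; i ≤ d, s ≥ ⟨n, m_i⟩]`. -/
abbrev BaseRing : Type _ := MvPolynomial {p : Fin d × ℕ // g.wt n (Sum.inl p.1) ≤ p.2} k

/-- The inclusion of `k[Z_{i,s} ; i ≤ d, s ≥ ⟨n, m_i⟩]` in `k[Z_∞]`. -/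
def baseInclusion : g.BaseRing n k →ₐ[k] MvPolynomial ((Fin d ⊕ Fin e) × ℕ) k :=
  MvPolynomial.rename fun p => (Sum.inl p.1.1, p.1.2)

instance finite_lowVariables :
    Finite {p : (Fin d ⊕ Fin e) × ℕ // p.2 < g.wt n p.1} := by
  let f : {p : (Fin d ⊕ Fin e) × ℕ // p.2 < g.wt n p.1} → Σ i, Fin (g.wt n i) :=
    fun p => ⟨p.1.1, ⟨p.1.2, p.2⟩⟩
  refine Finite.of_injective f ?_
  rintro ⟨⟨i, s⟩, hs⟩ ⟨⟨j, t⟩, ht⟩ h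
  simp only [f, Sigma.mk.injEq] at h
  obtain ⟨rfl, h⟩ := h
  simp only [heq_eq_eq, Fin.mk.injEq] at h
  subst h
  rfl

/-- The ideal of `R = L⟦Z_{i,s} ; s < ⟨n, m_i⟩⟧` generated by the variables. -/
abbrev varIdeal : Ideal (g.SeriesRing k n) := Ideal.span (Set.range MvPowerSeries.X)

variable {n k}

/-- The properties which characterize the morphism `k[Z_∞] → R`. -/
structure IsParametrization (ε : MvPolynomial ((Fin d ⊕ Fin e) × ℕ) k →ₐ[k] g.SeriesRing k n) :
    Prop where
  isTruncatedArc : g.IsTruncatedArc n (g.varIdeal n k) ε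
  apply_high : ∀ p : {p : Fin d × ℕ // g.wt n (Sum.inl p.1) ≤ p.2},
    ε (MvPolynomial.X (Sum.inl p.1.1, p.1.2)) =
      MvPowerSeries.C (algebraMap (g.BaseRing n k) (g.BaseField k n) (MvPolynomial.X p))
  apply_low : ∀ p : {p : (Fin d ⊕ Fin e) × ℕ // p.2 < g.wt n p.1},
    ε (MvPolynomial.X p.1) = MvPowerSeries.X p

variable (n k) in
theorem exists_isParametrization :
    ∃ ε : MvPolynomial ((Fin d ⊕ Fin e) × ℕ) k →ₐ[k] g.SeriesRing k n, g.IsParametrization ε := by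
  classical
  let x : Fin d → PowerSeries (g.SeriesRing k n) := fun i => PowerSeries.mk fun s =>
    if h : g.wt n (Sum.inl i) ≤ s then
      MvPowerSeries.C (algebraMap (g.BaseRing n k) (g.BaseField k n) (MvPolynomial.X ⟨(i, s), h⟩))
    else MvPowerSeries.X ⟨(Sum.inl i, s), not_le.1 h⟩
  let low : Fin e → ℕ → g.SeriesRing k n := fun q s =>
    if h : s < g.wt n (Sum.inr q) then MvPowerSeries.X ⟨(Sum.inr q, s), h⟩ else 0
  have hx : ∀ i, HasOrderMod (g.varIdeal n k) (g.wt n (Sum.inl i)) (x i) := by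
    intro i
    refine hasOrderMod_of_coeff (fun s hs => ?_) ?_
    · rw [PowerSeries.coeff_mk, dif_neg (not_le.2 hs)]
      exact Ideal.subset_span ⟨_, rfl⟩
    -- The leading coefficient is a variable of the base field, hence a unit of `R`.
    · rw [PowerSeries.coeff_mk, dif_pos le_rfl]
      refine IsUnit.map _ (isUnit_iff_ne_zero.2 ?_)
      rw [map_ne_zero_iff _ (IsFractionRing.injective _ _)]
      exact MvPolynomial.X_ne_zero _
  have hlow : ∀ q, ∀ s < g.wt n (Sum.inr q), low q s ∈ g.varIdeal n k := by
    intro q s hs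
    simp only [low, dif_pos hs]
    exact Ideal.subset_span ⟨_, rfl⟩
  obtain ⟨ε, h1, h2, h3⟩ := g.exists_isTruncatedArc (k := k) hx low hlow
  refine ⟨ε, h1, fun p => ?_, ?_⟩
  · rw [h2, PowerSeries.coeff_mk, dif_pos p.2]
  · rintro ⟨⟨i | q, s⟩, hs⟩
    · rw [h2, PowerSeries.coeff_mk, dif_neg (not_le.2 hs)]
    · rw [h3 q s hs]
      exact dif_pos hs

variable (n k) in
/-- The constant term, as a morphism of `k`-algebras. -/
def constTerm : g.SeriesRing k n →ₐ[k] g.BaseField k n :=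
  { MvPowerSeries.constantCoeff with
    commutes' := fun r => by
      change MvPowerSeries.constantCoeff (algebraMap k (g.SeriesRing k n) r) = _
      rw [MvPowerSeries.algebraMap_apply, MvPowerSeries.constantCoeff_C] }

theorem constTerm_eq_zero_iff {f : g.SeriesRing k n} :
    g.constTerm n k f = 0 ↔ f ∈ g.varIdeal n k := by
  rw [varIdeal, span_X_eq_ker_constantCoeff]
  rfl

theorem isUnit_of_constTerm_ne_zero {f : g.SeriesRing k n} (hf : g.constTerm n k f ≠ 0) :
    IsUnit f :=
  MvPowerSeries.isUnit_iff_constantCoeff.2 (isUnit_iff_ne_zero.2 hf)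

namespace IsParametrization

variable {g} {ε : MvPolynomial ((Fin d ⊕ Fin e) × ℕ) k →ₐ[k] g.SeriesRing k n}

theorem apply_baseInclusion (h : g.IsParametrization ε) (c : g.BaseRing n k) :
    ε (g.baseInclusion n k c) =
      MvPowerSeries.C (algebraMap (g.BaseRing n k) (g.BaseField k n) c) := by
  have : (ε.comp (g.baseInclusion n k)) =
      { (MvPowerSeries.C (σ := {p : (Fin d ⊕ Fin e) × ℕ // p.2 < g.wt n p.1})
          (R := g.BaseField k n)).comp (algebraMap (g.BaseRing n k) (g.BaseField k n)) with
        commutes' := fun r => by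
          change MvPowerSeries.C (algebraMap (g.BaseRing n k) (g.BaseField k n)
            (algebraMap k _ r)) = _
          rw [← IsScalarTower.algebraMap_apply, MvPowerSeries.algebraMap_apply] } := by
    apply MvPolynomial.algHom_ext
    intro p
    change ε (MvPolynomial.rename _ (MvPolynomial.X p)) = _
    rw [MvPolynomial.rename_X]
    exact h.apply_high p
  exact DFunLike.congr_fun this c

/-- The generic arc `k[Z_∞] → L`. -/
def _root_.ToricArc.Generators.genericArc
    (ε : MvPolynomial ((Fin d ⊕ Fin e) × ℕ) k →ₐ[k] g.SeriesRing k n) :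
    MvPolynomial ((Fin d ⊕ Fin e) × ℕ) k →ₐ[k] g.BaseField k n :=
  (g.constTerm n k).comp ε

theorem genericArc_baseInclusion (h : g.IsParametrization ε) (c : g.BaseRing n k) :
    genericArc ε (g.baseInclusion n k c) = algebraMap _ _ c := by
  change MvPowerSeries.constantCoeff (ε _) = _
  rw [h.apply_baseInclusion, MvPowerSeries.constantCoeff_C]

theorem genericArc_high (h : g.IsParametrization ε) {i : Fin d} {s : ℕ}
    (hs : g.wt n (Sum.inl i) ≤ s) :
    genericArc ε (MvPolynomial.X (Sum.inl i, s)) =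
      algebraMap (g.BaseRing n k) (g.BaseField k n) (MvPolynomial.X ⟨(i, s), hs⟩) := by
  change MvPowerSeries.constantCoeff (ε _) = _
  rw [h.apply_high ⟨(i, s), hs⟩, MvPowerSeries.constantCoeff_C]

theorem genericArc_low (h : g.IsParametrization ε) {i : Fin d ⊕ Fin e} {s : ℕ}
    (hs : s < g.wt n i) : genericArc ε (MvPolynomial.X (i, s)) = 0 := by
  change MvPowerSeries.constantCoeff (ε _) = _
  rw [h.apply_low ⟨(i, s), hs⟩, MvPowerSeries.constantCoeff_X]

theorem isTruncatedArc_genericArc (h : g.IsParametrization ε) :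
    g.IsTruncatedArc n ⊥ (genericArc ε) :=
  h.isTruncatedArc.map (g.constTerm n k) fun _ hf => g.constTerm_eq_zero_iff.2 hf

theorem toricIdeal_le_ker (hn : IsNonneg (σ := σ) n) (h : g.IsParametrization ε) :
    arcIdeal (g.toricIdeal k) ≤ RingHom.ker (genericArc ε) :=
  h.isTruncatedArc_genericArc.toricIdeal_le (h.isTruncatedArc_genericArc.ciIdeal_le hn)

theorem isUnit_apply {a : MvPolynomial ((Fin d ⊕ Fin e) × ℕ) k}
    (ha : genericArc ε a ≠ 0) : IsUnit (ε a) :=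
  g.isUnit_of_constTerm_ne_zero ha

theorem isUnit_apply_X (hn : IsNonneg (σ := σ) n) (h : g.IsParametrization ε)
    (i : Fin d ⊕ Fin e) : IsUnit (ε (MvPolynomial.X (i, g.wt n i))) := by
  rw [← coeff_arcOf]
  exact (h.isTruncatedArc.hasOrderMod hn i).isUnit_coeff

/-- The points of the arc spaces of `V_σ` and `W` which are images of the generic arc. -/
def _root_.ToricArc.Generators.IsGenericArcPoint {I : Ideal (MvPolynomial (Fin d ⊕ Fin e) k)}
    (ε : MvPolynomial ((Fin d ⊕ Fin e) × ℕ) k →ₐ[k] g.SeriesRing k n)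
    (x : PrimeSpectrum (ArcRing I)) : Prop :=
  x.asIdeal.comap (Ideal.Quotient.mk (arcIdeal I)) = RingHom.ker (genericArc ε)

variable (ε) in
/-- The completion ring `R/⟨ε([j])⟩`. -/
abbrev _root_.ToricArc.Generators.CompletionRing : Type _ :=
  g.SeriesRing k n ⧸ Ideal.map ε (arcIdeal (g.ciIdeal k))

variable (ε) in
/-- The image of the ideal of the variables in `R/⟨ε([j])⟩`. -/
abbrev _root_.ToricArc.Generators.completionIdeal : Ideal (CompletionRing ε) :=
  (g.varIdeal n k).map (Ideal.Quotient.mk _)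

theorem map_arcIdeal_le (hn : IsNonneg (σ := σ) n) (h : g.IsParametrization ε) :
    Ideal.map ε (arcIdeal (g.ciIdeal k)) ≤ g.varIdeal n k := by
  rw [Ideal.map_le_iff_le_comap]
  intro a ha
  exact g.constTerm_eq_zero_iff.1 (h.isTruncatedArc_genericArc.ciIdeal_le hn ha)

theorem isLocalRing (hn : IsNonneg (σ := σ) n) (h : g.IsParametrization ε) :
    IsLocalRing (CompletionRing ε) := by
  have : Nontrivial (CompletionRing ε) := by
    rw [Ideal.Quotient.nontrivial_iff]
    intro htop
    have h1 := h.map_arcIdeal_le hn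
    rw [htop, top_le_iff, varIdeal, ← maximalIdeal_eq_span_X] at h1
    exact (IsLocalRing.maximalIdeal.isMaximal _).ne_top h1
  exact IsLocalRing.of_surjective' (Ideal.Quotient.mk _) Ideal.Quotient.mk_surjective

theorem maximalIdeal_eq [IsLocalRing (CompletionRing ε)] :
    IsLocalRing.maximalIdeal (CompletionRing ε) = completionIdeal ε := by
  rw [completionIdeal, varIdeal, ← maximalIdeal_eq_span_X]
  exact (IsLocalRing.map_maximalIdeal_of_surjective _ Ideal.Quotient.mk_surjective).symm

theorem isAdicComplete (hn : IsNonneg (σ := σ) n) (h : g.IsParametrization ε) :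
    IsAdicComplete (completionIdeal ε) (CompletionRing ε) := by
  have := h.isLocalRing hn
  have h1 : IsPrecomplete (completionIdeal ε) (CompletionRing ε) := isPrecomplete_quotient _ _
  -- Krull's intersection theorem for a noetherian local ring.
  have h2 : IsHausdorff (completionIdeal ε) (CompletionRing ε) := by
    rw [← maximalIdeal_eq]
    infer_instance
  exact { }

end IsParametrization

end Generators

/-! ### Formal neighborhoods of the generic arc. -/

namespace Generators

variable {N : Type*} [AddCommGroup N] {σ : PointedCone ℝ (ℝ ⊗[ℤ] N)} {d e : ℕ}
  {g : Generators σ d e} {n : N} {k : Type*} [Field k]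
  {ε : MvPolynomial ((Fin d ⊕ Fin e) × ℕ) k →ₐ[k] g.SeriesRing k n}
  {I : Ideal (MvPolynomial (Fin d ⊕ Fin e) k)} {x : PrimeSpectrum (ArcRing I)}
  {O : Type*} [CommRing O] [Algebra k O] [Algebra (ArcRing I) O] [IsScalarTower k (ArcRing I) O]

variable (I O) in
/-- The structure morphism from `k[Z_∞]` to an algebra over the coordinate ring of an arc scheme. -/
def toLocalRing : MvPolynomial ((Fin d ⊕ Fin e) × ℕ) k →ₐ[k] O :=
  (IsScalarTower.toAlgHom k (ArcRing I) O).comp (Ideal.Quotient.mkₐ k (arcIdeal I))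

theorem toLocalRing_eq_zero {a : MvPolynomial ((Fin d ⊕ Fin e) × ℕ) k} (ha : a ∈ arcIdeal I) :
    toLocalRing I O a = 0 := by
  change algebraMap (ArcRing I) O (Ideal.Quotient.mk (arcIdeal I) a) = 0
  rw [Ideal.Quotient.eq_zero_iff_mem.2 ha, map_zero]

theorem algHom_localRing_ext (x : PrimeSpectrum (ArcRing I))
    [IsLocalization.AtPrime O x.asIdeal] {T : Type*} [CommRing T] [Algebra k T]
    {f f' : O →ₐ[k] T}
    (h : ∀ a, f (toLocalRing I O a) = f' (toLocalRing I O a)) : f = f' := by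
  have : (f : O →+* T) = f' := by
    refine IsLocalization.ringHom_ext x.asIdeal.primeCompl (RingHom.ext fun b => ?_)
    obtain ⟨a, rfl⟩ := Ideal.Quotient.mk_surjective b
    exact h a
  ext a
  exact DFunLike.congr_fun this a

theorem IsParametrization.map_ker_genericArc (hε : g.IsParametrization ε) :
    (RingHom.ker (genericArc ε)).map
      (ε : MvPolynomial ((Fin d ⊕ Fin e) × ℕ) k →+* g.SeriesRing k n) = g.varIdeal n k := by
  refine le_antisymm (Ideal.map_le_iff_le_comap.2 fun a ha => ?_) (Ideal.span_le.2 ?_)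
  · exact g.constTerm_eq_zero_iff.1 ha
  · rintro _ ⟨p, rfl⟩
    have h := Ideal.mem_map_of_mem
      (ε : MvPolynomial ((Fin d ⊕ Fin e) × ℕ) k →+* g.SeriesRing k n)
      (RingHom.mem_ker.2 (hε.genericArc_low p.2))
    rwa [RingHom.coe_coe, hε.apply_low p] at h

namespace IsGenericArcPoint

variable [IsLocalization.AtPrime O x.asIdeal]

theorem mk_mem_iff (hx : IsGenericArcPoint ε x) (a : MvPolynomial ((Fin d ⊕ Fin e) × ℕ) k) :
    Ideal.Quotient.mk (arcIdeal I) a ∈ x.asIdeal ↔ genericArc ε a = 0 := by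
  rw [← RingHom.mem_ker, ← show _ = RingHom.ker (genericArc ε) from hx, Ideal.mem_comap]

theorem isUnit_toLocalRing (hx : IsGenericArcPoint ε x)
    {a : MvPolynomial ((Fin d ⊕ Fin e) × ℕ) k} (ha : genericArc ε a ≠ 0) :
    IsUnit (toLocalRing I O a) :=
  IsLocalization.map_units (M := x.asIdeal.primeCompl) O
    ⟨Ideal.Quotient.mk (arcIdeal I) a, fun h => ha ((hx.mk_mem_iff a).1 h)⟩

/-- The field `L` embeds in the local ring at the generic arc. -/
theorem exists_coefficientField (hε : g.IsParametrization ε) (hx : IsGenericArcPoint ε x) :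
    ∃ Λ : g.BaseField k n →ₐ[k] O,
      ∀ c, Λ (algebraMap (g.BaseRing n k) _ c) = toLocalRing I O (g.baseInclusion n k c) := by
  have hunit : ∀ c : nonZeroDivisors (g.BaseRing n k),
      IsUnit (((toLocalRing I O).comp (g.baseInclusion n k)) (c : g.BaseRing n k)) := by
    intro c
    refine hx.isUnit_toLocalRing ?_
    change genericArc ε (g.baseInclusion n k (c : g.BaseRing n k)) ≠ 0
    rw [hε.genericArc_baseInclusion, map_ne_zero_iff _ (IsFractionRing.injective _ _)]
    exact nonZeroDivisors.ne_zero c.2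
  exact ⟨IsLocalization.liftAlgHom (M := nonZeroDivisors (g.BaseRing n k)) hunit,
    fun c => IsLocalization.lift_eq hunit c⟩

/-- The morphism from the local ring at the generic arc to `R/⟨ε([j])⟩`. -/
theorem exists_toCompletionRing (hn : IsNonneg (σ := σ) n) (hε : g.IsParametrization ε)
    (hI : I ≤ g.toricIdeal k) (hx : IsGenericArcPoint ε x) :
    ∃ Θ : O →ₐ[k] CompletionRing ε,
      ∀ a, Θ (toLocalRing I O a) = Ideal.Quotient.mk _ (ε a) := by
  have := hε.isAdicComplete hn
  let φ : MvPolynomial ((Fin d ⊕ Fin e) × ℕ) k →ₐ[k] CompletionRing ε :=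
    (Ideal.Quotient.mkₐ k _).comp ε
  have hφ : g.IsTruncatedArc n (completionIdeal ε) φ :=
    hε.isTruncatedArc.map _ (Ideal.le_comap_map (f := Ideal.Quotient.mk _))
  -- Only `[j]` has been killed, but over this complete ring a truncated arc of `W` satisfies all
  -- the equations of `V_σ`.
  have hker : ∀ a ∈ arcIdeal I, φ a = 0 := fun a ha =>
    hφ.toricIdeal_le (fun b hb => Ideal.Quotient.eq_zero_iff_mem.2 (Ideal.mem_map_of_mem ε hb))
      (arcIdeal_mono hI ha)
  let ψ : ArcRing I →ₐ[k] CompletionRing ε := Ideal.Quotient.liftₐ (arcIdeal I) φ hker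
  have hψ : ∀ y : x.asIdeal.primeCompl, IsUnit (ψ y) := by
    rintro ⟨y, hy⟩
    obtain ⟨a, rfl⟩ := Ideal.Quotient.mk_surjective y
    exact (IsParametrization.isUnit_apply fun h => hy ((hx.mk_mem_iff a).2 h)).map
      (Ideal.Quotient.mk _)
  exact ⟨IsLocalization.liftAlgHom (M := x.asIdeal.primeCompl) hψ,
    fun a => IsLocalization.lift_eq hψ (Ideal.Quotient.mk _ a)⟩

variable [IsLocalRing O]

theorem maximalIdeal_eq (hx : IsGenericArcPoint ε x) :
    IsLocalRing.maximalIdeal O =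
      (RingHom.ker (genericArc ε)).map (toLocalRing I O : _ →+* O) := by
  rw [← IsLocalization.AtPrime.map_eq_maximalIdeal x.asIdeal O,
    ← show _ = RingHom.ker (genericArc ε) from hx,
    show (toLocalRing I O : _ →+* O) =
      (algebraMap (ArcRing I) O).comp (Ideal.Quotient.mk (arcIdeal I)) from rfl, ← Ideal.map_map,
    Ideal.map_comap_of_surjective _ Ideal.Quotient.mk_surjective]

theorem toLocalRing_mem (hx : IsGenericArcPoint ε x) {a : MvPolynomial ((Fin d ⊕ Fin e) × ℕ) k}
    (ha : genericArc ε a = 0) :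
    toLocalRing I O a ∈ IsLocalRing.maximalIdeal O := by
  have h := Ideal.mem_map_of_mem (toLocalRing I O : MvPolynomial ((Fin d ⊕ Fin e) × ℕ) k →+* O)
    (RingHom.mem_ker.2 ha)
  rwa [RingHom.coe_coe, ← hx.maximalIdeal_eq] at h

/-- The morphism from `R/⟨ε([j])⟩` to the truncations of the local ring at the generic arc. -/
theorem exists_fromCompletionRing (hε : g.IsParametrization ε)
    (hI : g.ciIdeal k ≤ I) (hx : IsGenericArcPoint ε x) (r : ℕ) :
    ∃ Φ : CompletionRing ε →ₐ[k] O ⧸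
        IsLocalRing.maximalIdeal O ^ r,
      ∀ a, Φ (Ideal.Quotient.mk _ (ε a)) = Ideal.Quotient.mk _ (toLocalRing I O a) := by
  set m := IsLocalRing.maximalIdeal O with hm
  let T := O ⧸ m ^ r
  let J : Ideal T := m.map (Ideal.Quotient.mk (m ^ r))
  have hJ : J ^ r = ⊥ := by
    rw [← Ideal.map_pow]
    exact Ideal.map_quotient_self _
  have hcomplete : IsAdicComplete J T := isAdicComplete_of_pow_eq_bot hJ
  obtain ⟨Λ, hΛ⟩ := hx.exists_coefficientField (O := O) hε
  let π : MvPolynomial ((Fin d ⊕ Fin e) × ℕ) k →ₐ[k] T :=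
    (Ideal.Quotient.mkₐ k (m ^ r)).comp (toLocalRing I O)
  have hπ : ∀ a, genericArc ε a = 0 → π a ∈ J := fun a ha =>
    Ideal.mem_map_of_mem (Ideal.Quotient.mk (m ^ r)) (hx.toLocalRing_mem ha)
  -- Series are evaluated in `O ⧸ m ^ r`: constants through the coefficient field, variables at the
  -- low coordinates, which are nilpotent there.
  obtain ⟨φ, hφC, hφX⟩ := exists_ringHom_of_pow_eq_bot
    (V := {p : (Fin d ⊕ Fin e) × ℕ // p.2 < g.wt n p.1})
    ((Ideal.Quotient.mk (m ^ r)).comp (Λ : g.BaseField k n →+* _))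
    (fun p => π (MvPolynomial.X p.1)) (J := J)
    (fun p => hπ _ (hε.genericArc_low p.2)) hJ
  let φ' : g.SeriesRing k n →ₐ[k] T :=
    { φ with
      commutes' := fun c => by
        change φ (algebraMap k (g.SeriesRing k n) c) = _
        rw [MvPowerSeries.algebraMap_apply, hφC]
        change Ideal.Quotient.mk (m ^ r) (Λ _) = _
        rw [Λ.commutes]
        rfl }
  have hvar : g.varIdeal n k ≤ J.comap φ' := by
    rw [varIdeal, Ideal.span_le]
    rintro _ ⟨p, rfl⟩
    change φ _ ∈ J
    rw [hφX]
    exact hπ _ (hε.genericArc_low p.2)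
  have h1 : g.IsTruncatedArc n J (φ'.comp ε) := hε.isTruncatedArc.map φ' hvar
  have h2 : g.IsTruncatedArc n J π := by
    refine ⟨fun i => hasOrderMod_of_coeff (fun s hs => ?_) ?_, fun q s hs => ?_, fun q s => ?_⟩
    · rw [coeff_arcOf]
      exact hπ _ (hε.genericArc_low hs)
    · rw [coeff_arcOf]
      refine (hx.isUnit_toLocalRing ?_).map (Ideal.Quotient.mk (m ^ r))
      rw [hε.genericArc_high le_rfl, map_ne_zero_iff _ (IsFractionRing.injective _ _)]
      exact MvPolynomial.X_ne_zero _
    · exact hπ _ (hε.genericArc_low hs)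
    · change Ideal.Quotient.mk (m ^ r) (toLocalRing I O _) = 0
      rw [toLocalRing_eq_zero, map_zero]
      exact Ideal.subset_span ⟨_, hI (Ideal.subset_span ⟨q, rfl⟩), _, rfl⟩
  -- Both are truncated arcs in `O ⧸ m ^ r` with the same free data, so rigidity forces equality on
  -- the high coefficients in the directions `q > d`.
  have hcomp : φ'.comp ε = π := by
    refine h1.ext h2 (fun i s hs => ?_) fun i s hs => ?_
    · change φ (ε _) = _
      rw [hε.apply_low ⟨(i, s), hs⟩, hφX]
    · change φ (ε _) = _
      rw [hε.apply_high ⟨(i, s), hs⟩, hφC]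
      change Ideal.Quotient.mk (m ^ r) (Λ _) = _
      rw [hΛ, baseInclusion, MvPolynomial.rename_X]
      rfl
  have hker : ∀ f ∈ Ideal.map ε (arcIdeal (g.ciIdeal k)), φ' f = 0 := by
    have : Ideal.map ε (arcIdeal (g.ciIdeal k)) ≤ RingHom.ker φ' := by
      rw [Ideal.map_le_iff_le_comap]
      intro a ha
      change (φ'.comp ε) a = 0
      rw [hcomp]
      change Ideal.Quotient.mk (m ^ r) (toLocalRing I O _) = 0
      rw [toLocalRing_eq_zero (arcIdeal_mono hI ha), map_zero]
    exact fun f hf => this hf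
  exact ⟨Ideal.Quotient.liftₐ _ φ' hker, fun a => DFunLike.congr_fun hcomp a⟩

/-- The formal neighborhood of the generic arc. -/
theorem nonempty_adicCompletion_algEquiv (hn : IsNonneg (σ := σ) n) (hε : g.IsParametrization ε)
    (hI : g.ciIdeal k ≤ I) (hI' : I ≤ g.toricIdeal k) (hx : IsGenericArcPoint ε x) :
    Nonempty (AdicCompletion (IsLocalRing.maximalIdeal O) O ≃ₐ[k] CompletionRing ε) := by
  obtain ⟨Θ, hΘ⟩ := hx.exists_toCompletionRing (O := O) hn hε hI'
  choose Φ hΦ using hx.exists_fromCompletionRing (O := O) hε hI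
  obtain ⟨Λ, hΛ⟩ := hx.exists_coefficientField (O := O) hε
  have hcomplete := hε.isAdicComplete hn
  have hmap : (IsLocalRing.maximalIdeal O).map
      (Θ : O →+* CompletionRing ε) = completionIdeal ε := by
    rw [hx.maximalIdeal_eq, Ideal.map_map]
    have hcomp : (Θ : O →+* CompletionRing ε).comp
        (toLocalRing I O : MvPolynomial ((Fin d ⊕ Fin e) × ℕ) k →+* O) =
        (Ideal.Quotient.mk (Ideal.map ε (arcIdeal (g.ciIdeal k)))).comp
          (ε : MvPolynomial ((Fin d ⊕ Fin e) × ℕ) k →+* g.SeriesRing k n) :=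
      RingHom.ext fun a => hΘ a
    rw [hcomp, ← Ideal.map_map, hε.map_ker_genericArc]
  have hΘΛ : ∀ c, Θ (Λ c) = Ideal.Quotient.mk _ (MvPowerSeries.C c) := by
    have : (Θ : O →+* CompletionRing ε).comp
        (Λ : g.BaseField k n →+* _) = (Ideal.Quotient.mk _).comp MvPowerSeries.C := by
      refine IsLocalization.ringHom_ext (nonZeroDivisors (g.BaseRing n k)) ?_
      refine RingHom.ext fun c => ?_
      change Θ (Λ (algebraMap (g.BaseRing n k) _ c)) = Ideal.Quotient.mk _ (MvPowerSeries.C _)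
      rw [hΛ, hΘ, hε.apply_baseInclusion]
    exact fun c => DFunLike.congr_fun this c
  have : IsAdicComplete ((IsLocalRing.maximalIdeal O).map
      (Θ : O →+* CompletionRing ε)) (CompletionRing ε) := by
    rwa [hmap]
  refine ToricArc.nonempty_adicCompletion_algEquiv _ Θ Φ (fun r o => ?_) fun s => ?_
  · have h : (Φ r).comp Θ = Ideal.Quotient.mkₐ k _ := by
      refine algHom_localRing_ext x fun a => ?_
      change Φ r (Θ (toLocalRing I O a)) = _
      rw [hΘ, hΦ]
      rfl
    exact DFunLike.congr_fun h o
  -- A series is approximated by its constant term, lifted to `O` by the coefficient field.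
  · obtain ⟨f, rfl⟩ := Ideal.Quotient.mk_surjective s
    refine ⟨Λ (g.constTerm n k f), ?_⟩
    rw [hΘΛ, hmap, ← map_sub]
    refine Ideal.mem_map_of_mem _ (g.constTerm_eq_zero_iff.1 ?_)
    change MvPowerSeries.constantCoeff (f - MvPowerSeries.C (MvPowerSeries.constantCoeff f)) = 0
    rw [map_sub, MvPowerSeries.constantCoeff_C, sub_self]

theorem nonempty_formalNbhdRing_algEquiv (hn : IsNonneg (σ := σ) n)
    (hε : g.IsParametrization ε) (hI : g.ciIdeal k ≤ I) (hI' : I ≤ g.toricIdeal k)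
    (hx : IsGenericArcPoint ε x) : Nonempty (FormalNbhdRing x ≃ₐ[k] CompletionRing ε) :=
  hx.nonempty_adicCompletion_algEquiv hn hε hI hI'

end IsGenericArcPoint

end Generators

/-! ### The generic point of the Nash set. -/

section Arc

variable {k : Type*} [Field k] {ι : Type*} {I : Ideal (MvPolynomial ι k)}

theorem order_eq_of_coeff_eq_zero_iff {T T' : Type*} [CommRing T] [CommRing T']
    {P : PowerSeries T} {Q : PowerSeries T'}
    (h : ∀ s, PowerSeries.coeff s P = 0 ↔ PowerSeries.coeff s Q = 0) : P.order = Q.order :=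
  le_antisymm
    (PowerSeries.le_order _ _ fun s hs => (h s).1 (PowerSeries.coeff_of_lt_order s hs))
    (PowerSeries.le_order _ _ fun s hs => (h s).2 (PowerSeries.coeff_of_lt_order s hs))

/-- The order depends only on which coefficients vanish, so any morphism with the right kernel may
replace the one to the residue field. -/
theorem arcOrd_mk {T : Type*} [CommRing T] [Algebra k T] (α : PrimeSpectrum (ArcRing I))
    (φ : MvPolynomial (ι × ℕ) k →ₐ[k] T)
    (hφ : ∀ a, Ideal.Quotient.mk (arcIdeal I) a ∈ α.asIdeal ↔ φ a = 0) (F : MvPolynomial ι k) :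
    arcOrd α (Ideal.Quotient.mk I F) = (MvPolynomial.aeval (arcOf φ) F).order := by
  refine order_eq_of_coeff_eq_zero_iff fun s => ?_
  rw [← apply_arcCoeff, ← hφ, PowerSeries.coeff_map, ← RingHom.mem_ker,
    Ideal.ker_algebraMap_residueField]
  have h : univArc I (Ideal.Quotient.mk I F) =
      PowerSeries.mapAlgHom (Ideal.Quotient.mkₐ k (arcIdeal I)) (HS F) := rfl
  rw [h, PowerSeries.mapAlgHom_apply, PowerSeries.coeff_map]
  rfl

end Arc

namespace Generators

variable {N : Type*} [AddCommGroup N] {σ : PointedCone ℝ (ℝ ⊗[ℤ] N)} {d e : ℕ}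
  {g : Generators σ d e} {n : N} {k : Type*} [Field k]
  {ε : MvPolynomial ((Fin d ⊕ Fin e) × ℕ) k →ₐ[k] g.SeriesRing k n}

theorem IsParametrization.exists_isGenericArcPoint (hn : IsNonneg (σ := σ) n)
    (hε : g.IsParametrization ε) :
    ∃ η : PrimeSpectrum (ArcRing (g.toricIdeal k)), IsGenericArcPoint ε η := by
  let f : ArcRing (g.toricIdeal k) →ₐ[k] g.BaseField k n :=
    Ideal.Quotient.liftₐ _ (genericArc ε) fun a ha => hε.toricIdeal_le_ker hn ha
  refine ⟨⟨RingHom.ker f, RingHom.ker_isPrime f⟩, ?_⟩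
  ext a
  exact Iff.rfl

theorem IsGenericArcPoint.arcImmersion {I J : Ideal (MvPolynomial (Fin d ⊕ Fin e) k)} (hIJ : I ≤ J)
    {x : PrimeSpectrum (ArcRing J)} (hx : IsGenericArcPoint ε x) :
    IsGenericArcPoint ε (arcImmersion hIJ x) := by
  ext a
  exact hx.mk_mem_iff a

theorem toricOrd_chi_X (i : Fin d ⊕ Fin e) :
    toricOrd k n (g.chi k (MvPolynomial.X i)) = g.wt n i := by
  simp [chi, toricOrd, wt]

/-- An arc of `V_σ` with the same orders as the generic arc is a specialization of it. -/
theorem IsParametrization.ker_genericArc_le (hε : g.IsParametrization ε) {κ : Type*} [Field κ]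
    [Algebra k κ] {χ : MvPolynomial ((Fin d ⊕ Fin e) × ℕ) k →ₐ[k] κ}
    (hχ : g.IsTruncatedArc n ⊥ χ)
    (hlow : ∀ i s, s < g.wt n i → χ (MvPolynomial.X (i, s)) = 0) :
    RingHom.ker (genericArc ε) ≤ RingHom.ker χ := by
  classical
  let c : g.BaseRing n k →ₐ[k] κ := χ.comp (g.baseInclusion n k)
  have hq : (RingHom.ker c).IsPrime := RingHom.ker_isPrime c
  -- The leading coefficients of `χ` in the directions `i ≤ d` are nonzero, so the corresponding
  -- variables are units in `B` and a truncated arc exists over `B`. This ring embeds in the base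
  -- field through `β` and maps to `κ` through `γ`.
  let B := Localization.AtPrime (RingHom.ker c)
  have hcX : ∀ p, c (MvPolynomial.X p) = χ (MvPolynomial.X (Sum.inl p.1.1, p.1.2)) := fun p => by
    change χ (MvPolynomial.rename _ _) = _
    rw [MvPolynomial.rename_X]
  let x : Fin d → PowerSeries B := fun i => PowerSeries.mk fun s =>
    if h : g.wt n (Sum.inl i) ≤ s then
      algebraMap (g.BaseRing n k) B (MvPolynomial.X ⟨(i, s), h⟩) else 0
  have hx : ∀ i, HasOrderMod ⊥ (g.wt n (Sum.inl i)) (x i) := by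
    intro i
    refine hasOrderMod_of_coeff (fun s hs => ?_) ?_
    · rw [PowerSeries.coeff_mk, dif_neg (not_le.2 hs)]
      exact zero_mem _
    · rw [PowerSeries.coeff_mk, dif_pos le_rfl]
      refine IsLocalization.map_units (M := (RingHom.ker c).primeCompl) B ⟨_, fun h => ?_⟩
      replace h : c (MvPolynomial.X _) = 0 := h
      rw [hcX, ← coeff_arcOf] at h
      exact (hχ.hasOrderMod_inl i).isUnit_coeff.ne_zero h
  obtain ⟨φ, hφ, hφl, hφr⟩ := g.exists_isTruncatedArc (k := k) hx (fun _ _ => 0)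
    fun _ _ _ => zero_mem _
  have hβ' : ∀ y : (RingHom.ker c).primeCompl,
      IsUnit (IsScalarTower.toAlgHom k (g.BaseRing n k) (g.BaseField k n) y) := by
    rintro ⟨y, hy⟩
    refine isUnit_iff_ne_zero.2 ((map_ne_zero_iff _ (IsFractionRing.injective _ _)).2 ?_)
    rintro rfl
    exact hy (zero_mem _)
  have hγ' : ∀ y : (RingHom.ker c).primeCompl, IsUnit (c y) := fun y => isUnit_iff_ne_zero.2 y.2
  let β : B →ₐ[k] g.BaseField k n := IsLocalization.liftAlgHom (S := B) hβ'
  let γ : B →ₐ[k] κ := IsLocalization.liftAlgHom (S := B) hγ'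
  have hβ : ∀ y, β (algebraMap (g.BaseRing n k) B y) = algebraMap _ _ y := fun y =>
    IsLocalization.lift_eq hβ' y
  have hγ : ∀ y, γ (algebraMap (g.BaseRing n k) B y) = c y := fun y =>
    IsLocalization.lift_eq hγ' y
  have hinj : Function.Injective β := by
    refine (IsLocalization.lift_injective_iff hβ').2 fun y z => ?_
    rw [(IsLocalization.injective B (RingHom.ker c).primeCompl_le_nonZeroDivisors).eq_iff]
    exact (IsFractionRing.injective (g.BaseRing n k) (g.BaseField k n)).eq_iff.symm
  have hzero : ∀ i s, s < g.wt n i → φ (MvPolynomial.X (i, s)) = 0 := by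
    rintro (i | q) s hs
    · rw [hφl, PowerSeries.coeff_mk, dif_neg (not_le.2 hs)]
    · exact hφr q s hs
  have hhigh : ∀ i s (hs : g.wt n (Sum.inl i) ≤ s), φ (MvPolynomial.X (Sum.inl i, s)) =
      algebraMap (g.BaseRing n k) B (MvPolynomial.X ⟨(i, s), hs⟩) := by
    intro i s hs
    rw [hφl, PowerSeries.coeff_mk, dif_pos hs]
  -- Rigidity over the two fields identifies the images of `φ` with the generic arc and with `χ`; as
  -- `β` is injective, what vanishes on the former vanishes on the latter.
  have h1 : β.comp φ = genericArc ε := by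
    refine (hφ.map β bot_le).ext hε.isTruncatedArc_genericArc (fun i s hs => ?_) fun i s hs => ?_
    · rw [AlgHom.comp_apply, hzero i s hs, map_zero, hε.genericArc_low hs]
    · rw [AlgHom.comp_apply, hhigh i s hs, hβ, hε.genericArc_high hs]
  have h2 : γ.comp φ = χ := by
    refine (hφ.map γ bot_le).ext hχ (fun i s hs => ?_) fun i s hs => ?_
    · rw [AlgHom.comp_apply, hzero i s hs, map_zero, hlow i s hs]
    · rw [AlgHom.comp_apply, hhigh i s hs, hγ, hcX]
  intro a ha
  have ha' : β (φ a) = 0 := by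
    rw [← AlgHom.comp_apply, h1]
    exact ha
  rw [RingHom.mem_ker, ← h2, AlgHom.comp_apply, (map_eq_zero_iff β hinj).1 ha', map_zero]

theorem IsParametrization.algebraicIndependent (hε : g.IsParametrization ε) :
    AlgebraicIndependent k fun i =>
      genericArc ε (MvPolynomial.X (Sum.inl i, g.wt n (Sum.inl i))) := by
  let j : Fin d → {p : Fin d × ℕ // g.wt n (Sum.inl p.1) ≤ p.2} :=
    fun i => ⟨(i, g.wt n (Sum.inl i)), le_rfl⟩
  have hj : Function.Injective j := fun a b h => congrArg (fun p => p.1.1) h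
  have h : (MvPolynomial.aeval fun i =>
      genericArc ε (MvPolynomial.X (Sum.inl i, g.wt n (Sum.inl i)))) =
      (IsScalarTower.toAlgHom k (g.BaseRing n k) (g.BaseField k n)).comp
        (MvPolynomial.rename (R := k) j) := by
    apply MvPolynomial.algHom_ext
    intro i
    rw [MvPolynomial.aeval_X, hε.genericArc_high le_rfl, AlgHom.comp_apply, MvPolynomial.rename_X]
    rfl
  rw [AlgebraicIndependent, h]
  exact (IsFractionRing.injective (g.BaseRing n k) (g.BaseField k n)).comp
    (MvPolynomial.rename_injective j hj)

/-- The generic arc is the generic point of the Nash set. -/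
theorem IsGenericArcPoint.isGenericPoint (hn : IsNonneg (σ := σ) n) (hε : g.IsParametrization ε)
    {η : PrimeSpectrum (ArcRing (g.toricIdeal k))} (hη : IsGenericArcPoint ε η) :
    IsGenericPoint η (g.nashSet k n) := by
  refine subset_antisymm (closure_mono (Set.singleton_subset_iff.2 ?_))
    (closure_minimal (fun α hα => ?_) isClosed_closure)
  · intro f
    obtain ⟨F, rfl⟩ := Ideal.Quotient.mk_surjective f
    rw [arcOrd_mk η (genericArc ε) hη.mk_mem_iff,
      g.order_aeval_arcOf hn hε.isTruncatedArc_genericArc hε.algebraicIndependent]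
    rfl
  · rw [← PrimeSpectrum.le_iff_mem_closure]
    let χ : MvPolynomial ((Fin d ⊕ Fin e) × ℕ) k →ₐ[k] α.asIdeal.ResidueField :=
      (IsScalarTower.toAlgHom k (ArcRing (g.toricIdeal k)) _).comp (Ideal.Quotient.mkₐ k _)
    have hχ : ∀ a, Ideal.Quotient.mk (arcIdeal (g.toricIdeal k)) a ∈ α.asIdeal ↔ χ a = 0 := by
      intro a
      conv_lhs => rw [← Ideal.ker_algebraMap_residueField α.asIdeal]
      exact Iff.rfl
    -- Of the equality `ord_α = ord_n`, only the values on the generators `χ^{m_i}` are needed.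
    have hord : ∀ i, (arcOf χ i).order = g.wt n i := by
      intro i
      rw [← toricOrd_chi_X (k := k), ← MvPolynomial.aeval_X (R := k) (arcOf χ) i,
        ← arcOrd_mk α χ hχ]
      exact hα _
    have hker : ∀ a ∈ arcIdeal (g.toricIdeal k), χ a = 0 := fun a ha => by
      rw [← hχ, Ideal.Quotient.eq_zero_iff_mem.2 ha]
      exact zero_mem _
    have hlow : ∀ i s, s < g.wt n i → χ (MvPolynomial.X (i, s)) = 0 := by
      intro i s hs
      rw [← coeff_arcOf]
      exact PowerSeries.coeff_of_lt_order s (by rw [hord]; exact_mod_cast hs)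
    have htrunc : g.IsTruncatedArc n ⊥ χ := by
      refine ⟨fun i => hasOrderMod_of_coeff (fun s hs => ?_) ?_, fun q s hs => ?_, fun q s => ?_⟩
      · rw [coeff_arcOf]
        exact hlow _ s hs
      · exact isUnit_iff_ne_zero.2 (PowerSeries.order_eq_nat.1 (hord (Sum.inl i))).1
      · exact hlow _ s hs
      · exact hker _ (Ideal.subset_span ⟨_, g.ciIdeal_le k (Ideal.subset_span ⟨q, rfl⟩), _, rfl⟩)
    intro b hb
    obtain ⟨a, rfl⟩ := Ideal.Quotient.mk_surjective b
    exact (hχ a).2 (hε.ker_genericArc_le htrunc hlow ((hη.mk_mem_iff a).1 hb))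

end Generators

end ToricArc

end

theorem mainTheorem6 {k : Type*} [Field k] [CharZero k]
    {N : Type*} [AddCommGroup N] [Module.Free ℤ N] [Module.Finite ℤ N]
    (σ : PointedCone ℝ (TensorProduct ℤ ℝ N)) (hσ : ToricArc.IsToricCone σ)
    {d e : ℕ} (g : ToricArc.Generators σ d e)
    (n : N) (hn : TensorProduct.tmul ℤ (1 : ℝ) n ∈ σ) :
    ∃ η : PrimeSpectrum (ToricArc.ArcRing (g.toricIdeal k)),
      IsGenericPoint η (g.nashSet k n) ∧
      ∃ ε : MvPolynomial ((Fin d ⊕ Fin e) × ℕ) k →ₐ[k] g.SeriesRing k n,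
        -- `ε` is the identity on the variables `Z_{i,s}`, `i ≤ d`, `s ≥ ⟨n, m_i⟩`
        (∀ p : {p : Fin d × ℕ // g.wt n (Sum.inl p.1) ≤ p.2},
          ε (MvPolynomial.X (Sum.inl p.1.1, p.1.2)) =
            MvPowerSeries.C (algebraMap
              (MvPolynomial {p : Fin d × ℕ // g.wt n (Sum.inl p.1) ≤ p.2} k)
              (g.BaseField k n) (MvPolynomial.X p))) ∧
        -- and on the variables `Z_{i,s}`, `i ≤ h`, `s < ⟨n, m_i⟩`
        (∀ p : {p : (Fin d ⊕ Fin e) × ℕ // p.2 < g.wt n p.1},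
          ε (MvPolynomial.X p.1) = MvPowerSeries.X p) ∧
        -- (i)
        ((∃ _ : IsLocalRing
              (g.SeriesRing k n ⧸ Ideal.map ε (ToricArc.arcIdeal (g.ciIdeal k))),
            IsNoetherianRing
              (g.SeriesRing k n ⧸ Ideal.map ε (ToricArc.arcIdeal (g.ciIdeal k))) ∧
            IsAdicComplete
              (IsLocalRing.maximalIdeal
                (g.SeriesRing k n ⧸ Ideal.map ε (ToricArc.arcIdeal (g.ciIdeal k))))
              (g.SeriesRing k n ⧸ Ideal.map ε (ToricArc.arcIdeal (g.ciIdeal k)))) ∧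
          Nonempty (ToricArc.FormalNbhdRing η ≃ₐ[k]
            (g.SeriesRing k n ⧸ Ideal.map ε (ToricArc.arcIdeal (g.ciIdeal k)))) ∧
          Nonempty (ToricArc.FormalNbhdRing (ToricArc.arcImmersion (g.ciIdeal_le k) η) ≃ₐ[k]
            (g.SeriesRing k n ⧸ Ideal.map ε (ToricArc.arcIdeal (g.ciIdeal k))))) ∧
        -- (ii)
        (∀ i : Fin d ⊕ Fin e, IsUnit (ε (MvPolynomial.X (i, g.wt n i)))) ∧
        -- (iii)
        (∀ (q : Fin e) (s : ℕ),
          ε (ToricArc.arcCoeff (g.F k q) (g.relWt n (g.rel q) + s)) = 0) := by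
  have hn' := ToricArc.Generators.isNonneg_of_mem hn
  obtain ⟨ε, hε⟩ := g.exists_isParametrization n k
  obtain ⟨η, hη⟩ := hε.exists_isGenericArcPoint hn'
  have hloc := hε.isLocalRing hn'
  refine ⟨η, hη.isGenericPoint hn' hε, ε, hε.apply_high, hε.apply_low,
    -- The same result is applied at the two ends of the range of ideals: `i_σ` for `V_σ`, then `j`
    -- for `W`.
    ⟨⟨hloc, inferInstance, ?_⟩, hη.nonempty_formalNbhdRing_algEquiv hn' hε (g.ciIdeal_le k) le_rfl,
      (hη.arcImmersion (g.ciIdeal_le k)).nonempty_formalNbhdRing_algEquiv hn' hε le_rfl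
        (g.ciIdeal_le k)⟩,
    hε.isUnit_apply_X hn', hε.isTruncatedArc.apply_arcCoeff_F⟩
  rw [ToricArc.Generators.IsParametrization.maximalIdeal_eq]
  exact hε.isAdicComplete hn'
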